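/- \textbf{Model.} $n\ge 2$ asynchronous deterministic processes (possibly infinite state machines) communicate through $n$ atomic single-writer/multi-reader registers $R_1,\dots,R_n$; process $i$ is the only one that can write in $R_i$, and every process can read all registers. A step is one read or one write of a register by some process, followed by local computation. A register is a $b$-bit register if it holds values in $\{0,1\}^b$; it is unbounded if there is no limit on the values it can hold. A process that stops taking steps has crashed; the others are correct. In the $t$-resilient model at most $t$ processes crash in any execution. A task $(\mathcal I,\mathcal O,\Delta)$ for $n$ processes consists of a finite set $\mathcal I$ of input configurations (an input value for each process), a finite set $\mathcal O$ of output configurations (output values for some of the processes) and a map $\Delta:\mathcal I\to 2^{\mathcal O}$. An algorithm solves the task $t$-resiliently if, for every $\sigma\in\mathcal I$ and every execution in which the processes start with the private inputs given by $\sigma$ and at most $t$ processes crash, every correct process irrevocably decides an output value, and the output values of the correct processes form a configuration $\tau\in\Delta(\sigma)$. A process may keep taking steps after it has decided. \textbf{Theorem.} There exists an integer $\beta\ge 1$ such that, for all integers $n\ge 2$ and $t$ with $1\le t<\frac n2$, every task for $n$ processes that is solvable $t$-resiliently with unbounded registers is solvable $t$-resiliently with registers of $\beta t$ bits. -/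

import Mathlib

universe u v

namespace SharedMemory

/-- A task for `n` processes. An input configuration gives an input value to every process. An
output configuration gives output values to some of the processes (`none` means that the process
has no output in this configuration). `legal σ` is the set of output configurations allowed for
the input configuration `σ`. -/
structure Task (n : ℕ) (In : Type u) (Out : Type v) where
  inputs : Finset (Fin n → In)
  outputs : Finset (Fin n → Option Out)
  legal : (Fin n → In) → Set (Fin n → Option Out)
  legal_subset : ∀ σ ∈ inputs, ∀ τ ∈ legal σ, τ ∈ outputs

/-- One atomic operation on the shared memory together with its continuation: read register `j`
and go to the local state `k w`, where `w` is the value read, or write `w` in one's own register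
and go to the local state `s`. -/
inductive Op (n : ℕ) (V : Type) (S : Type) : Type
  | read (j : Fin n) (k : V → S) : Op n V S
  | write (w : V) (s : S) : Op n V S

/-- An algorithm for `n` deterministic processes that communicate through `n` single-writer
multi-reader registers with values in `V`. `output i s` is the value decided by process `i`, if it
has decided. A decision is irrevocable, but a process may go on taking steps after deciding. -/
structure Algorithm (n : ℕ) (V : Type) (In : Type u) (Out : Type v) where
  /-- local states, possibly infinitely many -/
  State : Type
  /-- initial content of the registers -/
  regInit : Fin n → V
  /-- initial local state of a process with a given private input -/
  start : Fin n → In → State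
  /-- the next operation of a process in a given local state -/
  op : Fin n → State → Op n V State
  output : Fin n → State → Option Out
  output_read : ∀ i s j k o, op i s = Op.read j k → output i s = some o →
    ∀ w, output i (k w) = some o
  output_write : ∀ i s w s' o, op i s = Op.write w s' → output i s = some o →
    output i s' = some o

variable {n : ℕ} {V : Type} {In : Type u} {Out : Type v}

/-- A global state of the system: the content of all registers and all local states. -/
structure Config (A : Algorithm n V In Out) where
  reg : Fin n → V
  loc : Fin n → A.State

namespace Algorithm

/-- The initial global state with inputs `σ`. -/
def init (A : Algorithm n V In Out) (σ : Fin n → In) : Config A where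
  reg := A.regInit
  loc := fun i => A.start i (σ i)

/-- The global state after one step of process `i`. -/
def stepBy (A : Algorithm n V In Out) (i : Fin n) (c : Config A) : Config A :=
  match A.op i (c.loc i) with
  | Op.read j k => { reg := c.reg, loc := Function.update c.loc i (k (c.reg j)) }
  | Op.write w s => { reg := Function.update c.reg i w, loc := Function.update c.loc i s }

/-- The global state after the first `m` steps of the execution with inputs `σ` in which the
`m`-th step is taken by process `sch m`. -/
def run (A : Algorithm n V In Out) (σ : Fin n → In) (sch : ℕ → Fin n) : ℕ → Config A
  | 0 => A.init σ
  | m + 1 => A.stepBy (sch m) (run A σ sch m)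

/-- Process `i` decides `o` in the execution. -/
def Decides (A : Algorithm n V In Out) (σ : Fin n → In) (sch : ℕ → Fin n) (i : Fin n)
    (o : Out) : Prop :=
  ∃ m : ℕ, A.output i ((A.run σ sch m).loc i) = some o

end Algorithm

/-- A process is correct (does not crash) in an execution if it never stops taking steps. -/
def Correct (sch : ℕ → Fin n) (i : Fin n) : Prop :=
  ∀ m : ℕ, ∃ m' : ℕ, m ≤ m' ∧ sch m' = i

/-- At most `t` processes crash. -/
def Resilient (t : ℕ) (sch : ℕ → Fin n) : Prop :=
  {i : Fin n | ¬ Correct sch i}.ncard ≤ t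

namespace Algorithm

/-- In the execution, all correct processes decide, and `τ` is the configuration formed by the
output values of the correct processes. -/
def HasOutcome (A : Algorithm n V In Out) (σ : Fin n → In) (sch : ℕ → Fin n)
    (τ : Fin n → Option Out) : Prop :=
  ∀ i : Fin n, (Correct sch i → ∃ o : Out, τ i = some o ∧ A.Decides σ sch i o) ∧
    (¬ Correct sch i → τ i = none)

/-- The algorithm solves the task in the `t`-resilient model. -/
def Solves (A : Algorithm n V In Out) (T : Task n In Out) (t : ℕ) : Prop :=
  ∀ σ ∈ T.inputs, ∀ sch : ℕ → Fin n, Resilient t sch →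
    ∃ τ ∈ T.legal σ, A.HasOutcome σ sch τ

end Algorithm

/-- The task is solvable `t`-resiliently with registers that hold values in `V`. -/
def Task.SolvableWith (T : Task n In Out) (t : ℕ) (V : Type) : Prop :=
  ∃ A : Algorithm n V In Out, A.Solves T t

/-- Solvability with unbounded-size registers: no limit on the values stored in a register. -/
def Task.SolvableUnbounded (T : Task n In Out) (t : ℕ) : Prop :=
  ∃ V : Type, T.SolvableWith t V

/-- Solvability with registers of `b` bits. -/
def Task.SolvableBits (T : Task n In Out) (t b : ℕ) : Prop :=
  T.SolvableWith t (Fin b → Bool)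

end SharedMemory

/-! Only countably many register values matter: the set of inputs is finite, and a configuration is
determined by the inputs and a finite list of steps. So the given algorithm may be assumed to store
natural numbers. Local states stay unbounded; only registers have to shrink. The small registers
therefore serve as communication links, and over these links the large registers are emulated.

Links. The processes form a ring, and each one sends to its `t + 1` successors. A link costs three
bits per register: data and toggle bits for the outgoing stream and an acknowledgement bit for the
incoming one (alternating-bit protocol, messages in unary). The invariant `linkInv` gives safety and
`exists_delivery` gives liveness. Among `t + 1` successors at least one is correct, so flooded
information reaches every correct process (`correct_connected`). In all, `3 * (t + 1) ≤ 6 * t` bits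
suffice.

Emulation. Processes flood all that they know about each other. A write issues a new entry and waits
until `n - t` processes are known to know it. A read first stamps a query, waits for a quorum, picks
the latest entry it knows, and waits for a second quorum that knows this entry too. Since `2 * t <
n`, any two quorums meet, so a read returns an entry at least as recent as the one committed when it
began (`committed_le_result`) and committed by the time it ends (`result_le_committed`).

Linearization. A register holds its committed entry, the latest one known to `n - t` processes. A
write takes effect when its entry becomes committed, and a read at the first moment of its operation
when the committed entry has reached its result; no entry is skipped, so the two are then equal.
Operations taking effect together are ordered reads first. The result is a genuine run with the same
correct processes (`exists_run`), and its legal outcome is the outcome of the emulation. -/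

namespace SharedMemory

/-! ### Changing the set of register values; reduction to natural numbers. -/

variable {n : ℕ} {V W : Type} {In : Type u} {Out : Type v}

namespace Algorithm

/-- The algorithm `A` with register values encoded by `f` and decoded by `g`. -/
def recode (A : Algorithm n V In Out) (f : V → W) (g : W → V) : Algorithm n W In Out where
  State := A.State
  regInit := fun j => f (A.regInit j)
  start := A.start
  op := fun i s => match A.op i s with
    | Op.read j k => Op.read j (fun w => k (g w))
    | Op.write w s' => Op.write (f w) s'
  output := A.output
  output_read := by
    intro i s j k o h ho w
    cases hop : A.op i s with
    | read j' k' =>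
      rw [hop] at h
      simp only [Op.read.injEq] at h
      rw [← h.2]
      exact A.output_read i s j' k' o hop ho _
    | write w' s' => rw [hop] at h; simp at h
  output_write := by
    intro i s w s' o h ho
    cases hop : A.op i s with
    | read j' k' => rw [hop] at h; simp at h
    | write w' s'' =>
      rw [hop] at h
      simp only [Op.write.injEq] at h
      rw [← h.2]
      exact A.output_write i s w' s'' o hop ho

/-- Decoding has to invert encoding only on values that occur in the run. This is what allows a `V`
of arbitrary cardinality to be replaced by `ℕ`. -/
theorem run_recode (A : Algorithm n V In Out) (f : V → W) (g : W → V) (σ : Fin n → In)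
    (sch : ℕ → Fin n)
    (hfg : ∀ m j, g (f ((A.run σ sch m).reg j)) = (A.run σ sch m).reg j) (m : ℕ) :
    (A.recode f g).run σ sch m =
      { reg := fun j => f ((A.run σ sch m).reg j), loc := (A.run σ sch m).loc } := by
  induction m with
  | zero => rfl
  | succ m ih =>
    simp only [run, ih]
    have hr := hfg m
    generalize A.run σ sch m = c at hr
    generalize sch m = i
    cases hop : A.op i (c.loc i) with
    | read j k =>
      have h1 : (A.recode f g).op i (c.loc i) = Op.read j (fun w => k (g w)) := by
        simp only [recode, hop]
      simp only [stepBy, hop, h1, hr]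
      rfl
    | write w s =>
      have h1 : (A.recode f g).op i (c.loc i) = Op.write (f w) s := by
        simp only [recode, hop]
      simp only [stepBy, hop, h1]
      congr 1
      funext j
      by_cases hj : j = i
      · subst hj; simp
      · simp [hj]

theorem Solves.recode {A : Algorithm n V In Out} {T : Task n In Out} {t : ℕ} (hA : A.Solves T t)
    (f : V → W) (g : W → V)
    (hfg : ∀ σ ∈ T.inputs, ∀ sch m j, g (f ((A.run σ sch m).reg j)) = (A.run σ sch m).reg j) :
    (A.recode f g).Solves T t := by
  intro σ hσ sch hsch
  obtain ⟨τ, hτ, h⟩ := hA σ hσ sch hsch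
  refine ⟨τ, hτ, fun i => ⟨fun hi => ?_, (h i).2⟩⟩
  obtain ⟨o, ho, m, hm⟩ := (h i).1 hi
  refine ⟨o, ho, m, ?_⟩
  rw [run_recode A f g σ sch (hfg σ hσ sch)]
  exact hm

theorem run_eq_foldl (A : Algorithm n V In Out) (σ : Fin n → In) (sch : ℕ → Fin n) (m : ℕ) :
    A.run σ sch m = ((List.range m).map sch).foldl (fun c i => A.stepBy i c) (A.init σ) := by
  induction m with
  | zero => rfl
  | succ m ih => simp [List.range_succ, run, ih]

/-- A reachable configuration is a function of an input from a finite set and a finite list of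
process names, and there are only countably many such lists, although there are uncountably many
schedules. -/
theorem countable_values (A : Algorithm n V In Out) (I : Finset (Fin n → In)) :
    {v | ∃ σ ∈ I, ∃ sch m j, (A.run σ sch m).reg j = v}.Countable := by
  have : (⋃ σ ∈ (I : Set (Fin n → In)), Set.range (fun p : List (Fin n) × Fin n =>
      (p.1.foldl (fun c i => A.stepBy i c) (A.init σ)).reg p.2)).Countable :=
    I.finite_toSet.countable.biUnion fun σ _ => Set.countable_range _
  refine this.mono ?_
  rintro v ⟨σ, hσ, sch, m, j, rfl⟩
  simp only [Set.mem_iUnion, Set.mem_range]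
  exact ⟨σ, hσ, ((List.range m).map sch, j), by rw [run_eq_foldl]⟩

end Algorithm

theorem Task.SolvableUnbounded.solvableWith_nat {T : Task n In Out} {t : ℕ} (hn : 0 < n)
    (h : T.SolvableUnbounded t) : T.SolvableWith t ℕ := by
  obtain ⟨V, A, hA⟩ := h
  have : Nonempty V := ⟨A.regInit ⟨0, hn⟩⟩
  obtain ⟨f, hf⟩ := Set.countable_iff_exists_injOn.1 (A.countable_values T.inputs)
  exact ⟨_, hA.recode f (Function.invFunOn f _) fun σ hσ sch m j =>
    hf.leftInvOn_invFunOn ⟨σ, hσ, sch, m, j, rfl⟩⟩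

theorem Task.SolvableWith.of_embedding {T : Task n In Out} {t : ℕ} (h : T.SolvableWith t V)
    (f : V ↪ W) (hn : 0 < n) : T.SolvableWith t W := by
  obtain ⟨A, hA⟩ := h
  have : Nonempty V := ⟨A.regInit ⟨0, hn⟩⟩
  exact ⟨_, hA.recode f (Function.invFun f) fun σ hσ sch m j =>
    Function.leftInverse_invFun f.injective _⟩

/-! ### Steps, batches of simultaneous steps, and schedules built from batches. -/

namespace Algorithm

/-- The local state of process `i` after its next step in the configuration `c`. -/
def nextLoc (A : Algorithm n V In Out) (c : Config A) (i : Fin n) : A.State :=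
  match A.op i (c.loc i) with
  | Op.read j k => k (c.reg j)
  | Op.write _ s => s

/-- The content of the register of process `i` after its next step in the configuration `c`. -/
def nextReg (A : Algorithm n V In Out) (c : Config A) (i : Fin n) : V :=
  match A.op i (c.loc i) with
  | Op.read _ _ => c.reg i
  | Op.write w _ => w

/-- Process `i` is about to read in the configuration `c`. -/
def Reads (A : Algorithm n V In Out) (c : Config A) (i : Fin n) : Prop :=
  ∃ j k, A.op i (c.loc i) = Op.read j k

/-- A read counts as rewriting the reader's own register with its old content, so reads and writes
get one common form. -/
theorem stepBy_eq (A : Algorithm n V In Out) (c : Config A) (i : Fin n) :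
    A.stepBy i c = { reg := Function.update c.reg i (A.nextReg c i),
                     loc := Function.update c.loc i (A.nextLoc c i) } := by
  cases h : A.op i (c.loc i) <;> simp [stepBy, nextReg, nextLoc, h]

theorem output_nextLoc (A : Algorithm n V In Out) (c : Config A) (i : Fin n) {o : Out}
    (h : A.output i (c.loc i) = some o) : A.output i (A.nextLoc c i) = some o := by
  cases hop : A.op i (c.loc i) with
  | read j k => simpa [nextLoc, hop] using A.output_read i _ j k o hop h _
  | write w s => simpa [nextLoc, hop] using A.output_write i _ w s o hop h

theorem output_run_mono (A : Algorithm n V In Out) (σ : Fin n → In) (sch : ℕ → Fin n) (i : Fin n)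
    {o : Out} {m m' : ℕ} (hm : m ≤ m') (h : A.output i ((A.run σ sch m).loc i) = some o) :
    A.output i ((A.run σ sch m').loc i) = some o := by
  induction m', hm using Nat.le_induction with
  | base => exact h
  | succ m' _ ih =>
    rw [run, stepBy_eq]
    by_cases hi : i = sch m'
    · subst hi; simpa using A.output_nextLoc _ _ ih
    · simpa [hi] using ih

/-- The effect of one step of each process in a list in which the readers precede the writers. -/
theorem foldl_stepBy (A : Algorithm n V In Out) (l : List (Fin n)) (c : Config A)
    (hl : l.Pairwise fun i j => i ≠ j ∧ (A.Reads c i ∨ ¬ A.Reads c j)) :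
    l.foldl (fun c i => A.stepBy i c) c =
      { reg := fun j => if j ∈ l then A.nextReg c j else c.reg j,
        loc := fun j => if j ∈ l then A.nextLoc c j else c.loc j } := by
  induction l generalizing c with
  | nil => simp
  | cons i l ih =>
    rw [List.pairwise_cons] at hl
    obtain ⟨hi, hl⟩ := hl
    have hloc : ∀ j ∈ l, (A.stepBy i c).loc j = c.loc j := by
      intro j hj
      rw [stepBy_eq]
      simp [(hi j hj).1.symm]
    have hreads : ∀ j ∈ l, A.Reads (A.stepBy i c) j ↔ A.Reads c j := by
      intro j hj
      simp only [Reads, hloc j hj]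
    have hreg : ∀ j ∈ l, A.nextReg (A.stepBy i c) j = A.nextReg c j := by
      intro j hj
      unfold nextReg
      rw [hloc j hj]
      cases A.op j (c.loc j) with
      | read j' k => rw [stepBy_eq]; simp [(hi j hj).1.symm]
      | write w s => rfl
    have hnext : ∀ j ∈ l, A.nextLoc (A.stepBy i c) j = A.nextLoc c j := by
      intro j hj
      unfold nextLoc
      rw [hloc j hj]
      cases hop : A.op j (c.loc j) with
      | read j' k =>
        obtain ⟨j'', k', h⟩ : A.Reads c i :=
          (hi j hj).2.resolve_right (fun h => h ⟨j', k, hop⟩)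
        simp [stepBy, h]
      | write w s => rfl
    have hnot : i ∉ l := fun h => (hi i h).1 rfl
    rw [List.foldl_cons, ih]
    · congr 1
      · funext j
        by_cases hj : j ∈ l
        · simp [hj, hreg j hj]
        · by_cases hji : j = i
          · subst hji; simp [hj, stepBy_eq]
          · simp [hj, hji, stepBy_eq]
      · funext j
        by_cases hj : j ∈ l
        · simp [hj, hnext j hj]
        · by_cases hji : j = i
          · subst hji; simp [hj, stepBy_eq]
          · simp [hj, hji, stepBy_eq]
    · refine hl.imp_of_mem fun {a b} ha hb h => ⟨h.1, ?_⟩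
      rw [hreads a ha, hreads b hb]
      exact h.2

/-- If `F` is a set of processes and every process in `F` takes one step, the readers first, then
the effect is that of one common step. -/
theorem exists_batch (A : Algorithm n V In Out) (c : Config A) (F : Fin n → Prop) :
    ∃ l : List (Fin n), (∀ i, i ∈ l ↔ F i) ∧ ∀ c' : Config A,
      (∀ j, F j → c'.reg j = A.nextReg c j) → (∀ j, ¬ F j → c'.reg j = c.reg j) →
      (∀ j, F j → c'.loc j = A.nextLoc c j) → (∀ j, ¬ F j → c'.loc j = c.loc j) →
      l.foldl (fun c i => A.stepBy i c) c = c' := by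
  classical
  -- Readers go first, so they see the registers of `c`. The writers do not depend on the registers
  -- and each changes only its own, so their order is irrelevant.
  refine ⟨(List.finRange n).filter (fun i => decide (F i ∧ A.Reads c i)) ++
    (List.finRange n).filter (fun i => decide (F i ∧ ¬ A.Reads c i)), ?_, ?_⟩
  · intro i
    by_cases h : A.Reads c i <;> simp [h]
  · intro c' h1 h2 h3 h4
    rw [foldl_stepBy]
    · obtain ⟨r, s⟩ := c'
      congr 1
      · funext j
        by_cases hF : F j
        · by_cases h : A.Reads c j <;> simpa [h, hF] using (h1 j hF).symm
        · simpa [hF] using (h2 j hF).symm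
      · funext j
        by_cases hF : F j
        · by_cases h : A.Reads c j <;> simpa [h, hF] using (h3 j hF).symm
        · simpa [hF] using (h4 j hF).symm
    · rw [List.pairwise_append]
      refine ⟨?_, ?_, ?_⟩
      · refine (List.Nodup.filter _ (List.nodup_finRange n)).imp_of_mem fun {a b} ha hb h => ⟨h, ?_⟩
        simp only [List.mem_filter, decide_eq_true_eq] at ha
        exact Or.inl ha.2.2
      · refine (List.Nodup.filter _ (List.nodup_finRange n)).imp_of_mem fun {a b} ha hb h => ⟨h, ?_⟩
        simp only [List.mem_filter, decide_eq_true_eq] at hb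
        exact Or.inr hb.2.2
      · intro a ha b hb
        simp only [List.mem_filter, decide_eq_true_eq] at ha hb
        exact ⟨fun h => hb.2.2 (h ▸ ha.2.2), Or.inl ha.2.2⟩

/-- A sequence of configurations in which each is obtained from the previous one by a finite list
of steps is a subsequence of a run. -/
theorem exists_schedule (A : Algorithm n V In Out) (σ : Fin n → In) (c : ℕ → Config A)
    (l : ℕ → List (Fin n)) (h0 : c 0 = A.init σ)
    (hstep : ∀ m, (l m).foldl (fun c i => A.stepBy i c) (c m) = c (m + 1))
    (hinf : ∀ m, ∃ m', m ≤ m' ∧ l m' ≠ []) :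
    ∃ sch : ℕ → Fin n, ∃ pos : ℕ → ℕ, (∀ m, A.run σ sch (pos m) = c m) ∧
      (∀ x, ∃ m, x ≤ pos m) ∧ (∀ i, Correct sch i ↔ ∀ m, ∃ m', m ≤ m' ∧ i ∈ l m') := by
  -- `L m` is the concatenation of the first `m` batches. These lists are nested, so the entry at
  -- position `x` is the same in every `L m` long enough to have one; `N x` below is the first such
  -- `m`.
  set L : ℕ → List (Fin n) := fun m => Nat.rec [] (fun k r => r ++ l k) m with hL
  have hL0 : L 0 = [] := rfl
  have hLs : ∀ m, L (m + 1) = L m ++ l m := fun m => rfl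
  have hpre : ∀ m m', m ≤ m' → L m <+: L m' := by
    intro m m' h
    induction m', h using Nat.le_induction with
    | base => exact List.prefix_refl _
    | succ m' _ ih => exact ih.trans (by rw [hLs]; exact List.prefix_append _ _)
  have hlen : ∀ m m', m ≤ m' → (L m).length ≤ (L m').length := fun m m' h => (hpre m m' h).length_le
  have hfold : ∀ m, (L m).foldl (fun c i => A.stepBy i c) (A.init σ) = c m := by
    intro m
    induction m with
    | zero => simp [hL0, h0]
    | succ m ih => rw [hLs, List.foldl_append, ih, hstep]
  have hunb : ∀ x, ∃ m, x < (L m).length := by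
    intro x
    induction x with
    | zero =>
      obtain ⟨m, -, hm⟩ := hinf 0
      refine ⟨m + 1, ?_⟩
      rw [hLs, List.length_append]
      have := List.length_pos_iff.2 hm
      omega
    | succ x ih =>
      obtain ⟨m, hm⟩ := ih
      obtain ⟨m', hmm', hm'⟩ := hinf m
      refine ⟨m' + 1, ?_⟩
      rw [hLs, List.length_append]
      have := List.length_pos_iff.2 hm'
      have := hlen m m' hmm'
      omega
  classical
  set N : ℕ → ℕ := fun x => Nat.find (hunb x) with hN
  have hNx : ∀ x, x < (L (N x)).length := fun x => Nat.find_spec (hunb x)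
  set sch : ℕ → Fin n := fun x => (L (N x))[x]'(hNx x) with hsch
  have hget : ∀ m x (h : x < (L m).length), sch x = (L m)[x] := by
    intro m x h
    have hle : N x ≤ m := Nat.find_min' (hunb x) h
    exact (hpre _ _ hle).getElem (hNx x)
  have hrun : ∀ m, A.run σ sch (L m).length = c m := by
    intro m
    rw [run_eq_foldl, ← hfold]
    congr 1
    apply List.ext_getElem
    · simp
    · intro x h1 h2
      simp [hget m x h2]
  refine ⟨sch, fun m => (L m).length, hrun, fun x => ?_, fun i => ⟨fun h m => ?_, fun h x => ?_⟩⟩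
  · obtain ⟨m, hm⟩ := hunb x
    exact ⟨m, hm.le⟩
  · obtain ⟨y, hy, hi⟩ := h (L m).length
    have hpos : N y ≠ 0 := by
      intro h0
      have := hNx y
      rw [h0, hL0] at this
      simp at this
    obtain ⟨k, hk⟩ := Nat.exists_eq_succ_of_ne_zero hpos
    have hky : (L k).length ≤ y := by
      have := Nat.find_min (hunb y) (m := k) (by change k < N y; omega)
      omega
    have hy2 := hNx y
    rw [hk] at hy2
    have hmk : m ≤ k := by
      by_contra hlt
      have := hlen (k + 1) m (by omega)
      simp only [Nat.succ_eq_add_one] at hy2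
      omega
    refine ⟨k, hmk, ?_⟩
    have hg := hget (k + 1) y hy2
    rw [hi] at hg
    simp only [hLs] at hg
    rw [List.getElem_append_right hky] at hg
    rw [hg]
    exact List.getElem_mem _
  · obtain ⟨m, hm⟩ := hunb x
    obtain ⟨m', hmm', hi⟩ := h m
    obtain ⟨y, hy, hyi⟩ := List.getElem_of_mem hi
    have hlt : (L m').length + y < (L (m' + 1)).length := by
      rw [hLs, List.length_append]; omega
    refine ⟨(L m').length + y, by have := hlen m m' hmm'; omega, ?_⟩
    rw [hget (m' + 1) _ hlt]
    simp only [hLs]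
    rw [List.getElem_append_right (by omega)]
    simpa using hyi

end Algorithm
end SharedMemory

/-! ### Alternating-bit links between processes with bounded registers. -/

namespace SharedMemory

variable {n b : ℕ} {P : Type} [Encodable P] {In : Type u} {Out : Type v}

/-- A reactive program: `tick` is a spontaneous local step and `recv i j s p` is the local state of
process `i` after it has received the payload `p` from process `j` in state `s`. The payload that a
process sends depends only on its local state. -/
structure Protocol (n : ℕ) (P : Type) (In : Type u) (Out : Type v) where
  State : Type
  start : Fin n → In → State
  pay : State → P
  pay₀ : P
  pay_start : ∀ i x, pay (start i x) = pay₀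
  tick : Fin n → State → State
  recv : Fin n → Fin n → State → P → State
  output : Fin n → State → Option Out
  output_tick : ∀ i s o, output i s = some o → output i (tick i s) = some o
  output_recv : ∀ i j s p o, output i s = some o → output i (recv i j s p) = some o

/-- For every link `d`: the toggle bit and the data bit of the outgoing stream, and the
acknowledgement bit of the incoming stream. -/
abbrev Ports (b : ℕ) : Type := Fin (b + 1) → Bool × Bool × Bool

/-- The local state of a process that runs a protocol over alternating-bit links. The outgoing
stream on link `d` consists of the messages in unary. -/
structure Node (S P : Type) (b : ℕ) where
  app : S
  msg : Fin (b + 1) → P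
  pos : Fin (b + 1) → ℕ
  tog : Fin (b + 1) → Bool
  ack : Fin (b + 1) → Bool
  cnt : Fin (b + 1) → ℕ
  ctr : ℕ
  hold : Option (Ports b)

namespace Node

variable {S : Type}

/-- The content of the register of a process. -/
def ports (s : Node S P b) : Ports b :=
  fun d => (s.tog d, decide (s.pos d = Encodable.encode (s.msg d)), s.ack d)

/-- The link that a process handles next. -/
def slot (s : Node S P b) : Fin (b + 1) := Fin.ofNat (b + 1) (s.ctr / 2)

/-- The ports `v` carry a new incoming bit on link `d`. -/
def NewBit (s : Node S P b) (v : Ports b) (d : Fin (b + 1)) : Prop :=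
  s.ctr % 2 = 0 ∧ s.slot = d ∧ (v d).1 ≠ s.ack d

/-- The ports `v` acknowledge the current outgoing bit on link `d`. -/
def Acked (s : Node S P b) (v : Ports b) (d : Fin (b + 1)) : Prop :=
  s.ctr % 2 = 1 ∧ s.slot = d ∧ (v d).2.2 = s.tog d

end Node

namespace Protocol

open scoped Classical in
/-- The processing of the ports `v` read from a neighbour. -/
noncomputable def handle (G : Protocol n P In Out) (nb : Fin (b + 1) → Equiv.Perm (Fin n))
    (i : Fin n) (s : Node G.State P b) (v : Ports b) : Node G.State P b where
  -- A message with code `e` travels as `e` bits 0 followed by a bit 1. The bit 1 ends it, and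
  -- `cnt`, the number of zeros received before, is decoded.
  app := if s.NewBit v s.slot ∧ (v s.slot).2.1 = true then
      (match (Encodable.decode (s.cnt s.slot) : Option P) with
        | some p => G.recv i ((nb s.slot).symm i) s.app p
        | none => s.app)
    else s.app
  msg := fun d => if s.Acked v d ∧ s.pos d = Encodable.encode (s.msg d) then G.pay s.app else s.msg d
  pos := fun d => if s.Acked v d then
    (if s.pos d = Encodable.encode (s.msg d) then 0 else s.pos d + 1) else s.pos d
  tog := fun d => if s.Acked v d then !s.tog d else s.tog d
  ack := fun d => if s.NewBit v d then (v d).1 else s.ack d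
  cnt := fun d => if s.NewBit v d then (if (v d).2.1 = true then 0 else s.cnt d + 1) else s.cnt d
  ctr := s.ctr + 1
  hold := none

/-- The neighbour whose register is read next. -/
def target (nb : Fin (b + 1) → Equiv.Perm (Fin n)) {S : Type} (i : Fin n) (s : Node S P b) : Fin n :=
  if s.ctr % 2 = 0 then (nb s.slot).symm i else nb s.slot i

/-- The initial state of a node. -/
def node₀ (G : Protocol n P In Out) (b : ℕ) (s : G.State) : Node G.State P b where
  app := s
  msg := fun _ => G.pay₀
  pos := fun _ => 0
  tog := fun _ => true
  ack := fun _ => false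
  cnt := fun _ => 0
  ctr := 0
  hold := none

/-- The shared memory algorithm that runs the protocol `G` with links from `i` to `nb d i`. -/
noncomputable def algorithm (G : Protocol n P In Out) (nb : Fin (b + 1) → Equiv.Perm (Fin n)) :
    Algorithm n (Ports b) In Out where
  State := Node G.State P b
  -- Initial register contents cannot depend on the inputs; hence the common first payload `pay₀`.
  -- The toggle differs from the acknowledgement, so the first bit is pending from the beginning.
  regInit := fun _ d => (true, decide (0 = Encodable.encode G.pay₀), false)
  start := fun i x => G.node₀ b (G.start i x)
  op := fun i s => match s.hold with
    | none => Op.read (target nb i s) fun v => { s with app := G.tick i s.app, hold := some v }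
    | some v => Op.write (G.handle nb i s v).ports (G.handle nb i s v)
  output := fun i s => G.output i s.app
  output_read := by
    intro i s j k o h ho w
    cases hs : s.hold with
    | none =>
      simp only [hs, Op.read.injEq] at h
      rw [← h.2]
      exact G.output_tick i _ o ho
    | some v => simp [hs] at h
  output_write := by
    intro i s w s' o h ho
    cases hs : s.hold with
    | none => simp [hs] at h
    | some v =>
      simp only [hs, Op.write.injEq] at h
      rw [← h.2]
      simp only [handle]
      split_ifs
      · split
        · exact G.output_recv i _ _ _ o ho
        · exact ho
      · exact ho

/-- The local state of process `i` at time `m`. -/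
noncomputable def node (G : Protocol n P In Out) (nb : Fin (b + 1) → Equiv.Perm (Fin n))
    (σ : Fin n → In) (sch : ℕ → Fin n) (m : ℕ) (i : Fin n) : Node G.State P b :=
  ((G.algorithm nb).run σ sch m).loc i

/-! ### Safety of the links: the invariant. -/

section Run

variable (G : Protocol n P In Out) (nb : Fin (b + 1) → Equiv.Perm (Fin n))
  (σ : Fin n → In) (sch : ℕ → Fin n)

theorem node_zero (i : Fin n) : G.node nb σ sch 0 i = G.node₀ b (G.start i (σ i)) := rfl

theorem node_succ_of_ne {m : ℕ} {i : Fin n} (h : sch m ≠ i) :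
    G.node nb σ sch (m + 1) i = G.node nb σ sch m i := by
  simp only [node, Algorithm.run]
  rw [Algorithm.stepBy_eq]
  exact Function.update_of_ne (Ne.symm h) _ _

theorem reg_eq (m : ℕ) (i : Fin n) :
    ((G.algorithm nb).run σ sch m).reg i = (G.node nb σ sch m i).ports := by
  induction m generalizing i with
  | zero => rfl
  | succ m ih =>
    by_cases hi : sch m = i
    · subst hi
      have ih := ih (sch m)
      simp only [node, Algorithm.run] at ih ⊢
      generalize (G.algorithm nb).run σ sch m = c at ih ⊢
      generalize sch m = i at ih ⊢
      cases hs : (c.loc i).hold with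
      | none =>
        simp only [Algorithm.stepBy, algorithm, hs, Function.update_self]
        exact ih
      | some v => simp [Algorithm.stepBy, algorithm, hs]
    · rw [node_succ_of_ne G nb σ sch hi, ← ih i]
      simp only [Algorithm.run]
      rw [Algorithm.stepBy_eq]
      simp [Ne.symm hi]

theorem node_succ_none {m : ℕ} {i : Fin n} (hi : sch m = i)
    (h : (G.node nb σ sch m i).hold = none) :
    G.node nb σ sch (m + 1) i =
      { G.node nb σ sch m i with
        app := G.tick i (G.node nb σ sch m i).app
        hold := some (G.node nb σ sch m (target nb i (G.node nb σ sch m i))).ports } := by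
  subst hi
  rw [← reg_eq]
  simp only [node, Algorithm.run] at h ⊢
  generalize (G.algorithm nb).run σ sch m = c at h ⊢
  simp [Algorithm.stepBy, algorithm, h]

theorem node_succ_some {m : ℕ} {i : Fin n} (hi : sch m = i) {v : Ports b}
    (h : (G.node nb σ sch m i).hold = some v) :
    G.node nb σ sch (m + 1) i = G.handle nb i (G.node nb σ sch m i) v := by
  subst hi
  simp only [node, Algorithm.run] at h ⊢
  generalize (G.algorithm nb).run σ sch m = c at h ⊢
  simp [Algorithm.stepBy, algorithm, h]

/-- The invariant of link `d` from `i` to `nb d i`. -/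
structure LinkInv (m : ℕ) (i : Fin n) (d : Fin (b + 1)) : Prop where
  sent : ∃ m' ≤ m, (G.node nb σ sch m i).msg d = G.pay (G.node nb σ sch m' i).app
  pos_le : (G.node nb σ sch m i).pos d ≤ Encodable.encode ((G.node nb σ sch m i).msg d)
  cnt_of_ne : (G.node nb σ sch m (nb d i)).ack d ≠ (G.node nb σ sch m i).tog d →
    (G.node nb σ sch m (nb d i)).cnt d = (G.node nb σ sch m i).pos d
  cnt_of_eq : (G.node nb σ sch m (nb d i)).ack d = (G.node nb σ sch m i).tog d →
    (G.node nb σ sch m (nb d i)).cnt d =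
      if (G.node nb σ sch m i).pos d = Encodable.encode ((G.node nb σ sch m i).msg d) then 0
      else (G.node nb σ sch m i).pos d + 1
  hold_recv : ∀ v, (G.node nb σ sch m (nb d i)).hold = some v →
    (G.node nb σ sch m (nb d i)).NewBit v d →
    (v d).1 = (G.node nb σ sch m i).tog d ∧
      (v d).2.1 = decide ((G.node nb σ sch m i).pos d =
        Encodable.encode ((G.node nb σ sch m i).msg d))
  hold_send : ∀ v, (G.node nb σ sch m i).hold = some v → (G.node nb σ sch m i).Acked v d →
    (G.node nb σ sch m (nb d i)).ack d = (G.node nb σ sch m i).tog d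
  delivered : (G.node nb σ sch m (nb d i)).ack d = (G.node nb σ sch m i).tog d →
    (G.node nb σ sch m i).pos d = Encodable.encode ((G.node nb σ sch m i).msg d) →
    ∃ m₀, (G.node nb σ sch (m₀ + 1) (nb d i)).app =
      G.recv (nb d i) i (G.node nb σ sch m₀ (nb d i)).app ((G.node nb σ sch m i).msg d)

theorem linkInv_zero (i : Fin n) (d : Fin (b + 1)) : G.LinkInv nb σ sch 0 i d := by
  constructor <;> simp [node_zero, node₀, G.pay_start]

variable {σ sch}

/-- The delicate case is the flip of the toggle. The sender flips it only after its bit was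
consumed, and then the counter of the receiver is already the position of the next bit. -/
theorem LinkInv.succ_sender {m : ℕ} {i : Fin n} {d : Fin (b + 1)} (hne : nb d i ≠ i)
    (h : G.LinkInv nb σ sch m i d) (hi : sch m = i) : G.LinkInv nb σ sch (m + 1) i d := by
  have hj : G.node nb σ sch (m + 1) (nb d i) = G.node nb σ sch m (nb d i) :=
    node_succ_of_ne G nb σ sch (by rw [hi]; exact hne.symm)
  obtain ⟨m₁, hm₁, hs⟩ := h.sent
  cases hh : (G.node nb σ sch m i).hold with
  | none =>
    have hN := node_succ_none G nb σ sch hi hh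
    refine ⟨⟨m₁, by omega, ?_⟩, ?_, ?_, ?_, ?_, ?_, ?_⟩
    · rw [hN]; exact hs
    · rw [hN]; exact h.pos_le
    · rw [hN, hj]; exact h.cnt_of_ne
    · rw [hN, hj]; exact h.cnt_of_eq
    · rw [hN, hj]; exact h.hold_recv
    · rw [hN, hj]
      rintro v hv ⟨h1, h2, h3⟩
      simp only [Option.some.injEq] at hv
      simp only at h1 h3
      change (G.node nb σ sch m i).slot = d at h2
      rw [← hv, target, if_neg (by omega), h2] at h3
      exact h3
    · rw [hN, hj]; exact h.delivered
  | some v =>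
    have hN := node_succ_some G nb σ sch hi hh
    by_cases ha : (G.node nb σ sch m i).Acked v d
    · have heq := h.hold_send v hh ha
      -- A held new bit would carry the current toggle, which the receiver has already acknowledged.
      -- So no old value is in transit that could be mistaken for a new bit after the flip.
      have hnb : ∀ v', (G.node nb σ sch m (nb d i)).hold = some v' →
          ¬ (G.node nb σ sch m (nb d i)).NewBit v' d := by
        intro v' hv' hb
        exact hb.2.2 ((h.hold_recv v' hv' hb).1.trans heq.symm)
      by_cases hp : (G.node nb σ sch m i).pos d = Encodable.encode ((G.node nb σ sch m i).msg d)
      · refine ⟨⟨m, by omega, ?_⟩, ?_, ?_, ?_, ?_, ?_, ?_⟩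
        · rw [hN]; simp [handle, ha, hp]
        · rw [hN]; simp [handle, ha, hp]
        · rw [hN, hj]; simp [handle, ha, hp, heq, h.cnt_of_eq heq]
        · rw [hN, hj]; simp [handle, ha, heq]
        · rw [hj]; exact fun v' hv' hb => absurd hb (hnb v' hv')
        · rw [hN]; simp [handle]
        · rw [hN, hj]; simp [handle, ha, heq]
      · refine ⟨⟨m₁, by omega, ?_⟩, ?_, ?_, ?_, ?_, ?_, ?_⟩
        · rw [hN]; simpa only [handle, hp, and_false, if_false] using hs
        · rw [hN]; have := h.pos_le; simp [handle, ha, hp]; omega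
        · rw [hN, hj]; simp [handle, ha, hp, heq, h.cnt_of_eq heq]
        · rw [hN, hj]; simp [handle, ha, heq]
        · rw [hj]; exact fun v' hv' hb => absurd hb (hnb v' hv')
        · rw [hN]; simp [handle]
        · rw [hN, hj]; simp [handle, ha, heq]
    · refine ⟨⟨m₁, by omega, ?_⟩, ?_, ?_, ?_, ?_, ?_, ?_⟩
      · rw [hN]; simpa [handle, ha] using hs
      · rw [hN]; simpa [handle, ha] using h.pos_le
      · rw [hN, hj]; simpa [handle, ha] using h.cnt_of_ne
      · rw [hN, hj]; simpa only [handle, ha, false_and, if_false] using h.cnt_of_eq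
      · rw [hN, hj]; simpa only [handle, ha, false_and, if_false] using h.hold_recv
      · rw [hN]; simp [handle]
      · rw [hN, hj]; simpa only [handle, ha, false_and, if_false] using h.delivered

/-- A bit that looks new is the current bit of the sender even if it was read earlier, since the
sender cannot advance before that bit is acknowledged. When it ends a message, the counter equals
the code of the message, and this very step is the delivery. -/
theorem LinkInv.succ_receiver {m : ℕ} {i : Fin n} {d : Fin (b + 1)} (hne : nb d i ≠ i)
    (h : G.LinkInv nb σ sch m i d) (hm : sch m = nb d i) : G.LinkInv nb σ sch (m + 1) i d := by
  have hi : G.node nb σ sch (m + 1) i = G.node nb σ sch m i :=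
    node_succ_of_ne G nb σ sch (by rw [hm]; exact hne)
  obtain ⟨m₁, hm₁, hs⟩ := h.sent
  have hsent : ∃ m' ≤ m + 1, (G.node nb σ sch (m + 1) i).msg d =
      G.pay (G.node nb σ sch m' i).app := ⟨m₁, by omega, by rw [hi]; exact hs⟩
  cases hh : (G.node nb σ sch m (nb d i)).hold with
  | none =>
    have hN := node_succ_none G nb σ sch hm hh
    refine ⟨hsent, ?_, ?_, ?_, ?_, ?_, ?_⟩
    · rw [hi]; exact h.pos_le
    · rw [hN, hi]; exact h.cnt_of_ne
    · rw [hN, hi]; exact h.cnt_of_eq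
    · rw [hN, hi]
      rintro v hv ⟨h1, h2, h3⟩
      simp only [Option.some.injEq] at hv
      simp only at h1
      change (G.node nb σ sch m (nb d i)).slot = d at h2
      rw [← hv, target, if_pos h1, h2, Equiv.symm_apply_apply]
      exact ⟨rfl, rfl⟩
    · rw [hN, hi]; exact h.hold_send
    · rw [hi]
      intro h1 h2
      rw [hN] at h1
      exact h.delivered h1 h2
  | some v =>
    have hN := node_succ_some G nb σ sch hm hh
    by_cases hb : (G.node nb σ sch m (nb d i)).NewBit v d
    · obtain ⟨ht, hbit⟩ := h.hold_recv v hh hb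
      have hcnt := h.cnt_of_ne (fun heq => hb.2.2 (ht.trans heq.symm))
      refine ⟨hsent, ?_, ?_, ?_, ?_, ?_, ?_⟩
      · rw [hi]; exact h.pos_le
      · rw [hN, hi]; simp [handle, hb, ht]
      · rw [hN, hi]; simp [handle, hb, ht, hbit, hcnt]
      · rw [hN]; simp [handle]
      · rw [hN, hi]; simp [handle, hb, ht]
      · rw [hi]
        intro _ hp
        refine ⟨m, ?_⟩
        rw [hN]
        have hslot := hb.2.1
        have hbit' : (v d).2.1 = true := by rw [hbit, hp]; simp
        simp only [handle, hslot, hb, hbit', and_self, if_true, hcnt, hp, Encodable.encodek,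
          Equiv.symm_apply_apply]
    · refine ⟨hsent, ?_, ?_, ?_, ?_, ?_, ?_⟩
      · rw [hi]; exact h.pos_le
      · rw [hN, hi]; simpa only [handle, hb, if_false] using h.cnt_of_ne
      · rw [hN, hi]; simpa only [handle, hb, if_false] using h.cnt_of_eq
      · rw [hN]; simp [handle]
      · rw [hN, hi]; simpa only [handle, hb, if_false] using h.hold_send
      · rw [hi]
        intro h1 h2
        rw [hN] at h1
        simp only [handle, hb, if_false] at h1
        exact h.delivered h1 h2

theorem linkInv (hne : ∀ d i, nb d i ≠ i) (m : ℕ) (i : Fin n) (d : Fin (b + 1)) :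
    G.LinkInv nb σ sch m i d := by
  induction m with
  | zero => exact linkInv_zero G nb σ sch i d
  | succ m ih =>
    by_cases hi : sch m = i
    · exact ih.succ_sender G nb (hne d i) hi
    by_cases hj : sch m = nb d i
    · exact ih.succ_receiver G nb (hne d i) hj
    have h1 := node_succ_of_ne G nb σ sch hi
    have h2 := node_succ_of_ne G nb σ sch hj
    obtain ⟨m₁, hm₁, hs⟩ := ih.sent
    refine ⟨⟨m₁, by omega, by rw [h1]; exact hs⟩, ?_, ?_, ?_, ?_, ?_, ?_⟩
    · rw [h1]; exact ih.pos_le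
    · rw [h1, h2]; exact ih.cnt_of_ne
    · rw [h1, h2]; exact ih.cnt_of_eq
    · rw [h1, h2]; exact ih.hold_recv
    · rw [h1, h2]; exact ih.hold_send
    · rw [h1, h2]; exact ih.delivered

/-- A step of a process leaves the protocol state unchanged, or is a tick, or delivers a payload
that another process had at an earlier time. -/
theorem app_step (hne : ∀ d i, nb d i ≠ i) (m : ℕ) (i : Fin n) :
    (G.node nb σ sch (m + 1) i).app = (G.node nb σ sch m i).app ∨ sch m = i ∧
    ((G.node nb σ sch (m + 1) i).app = G.tick i (G.node nb σ sch m i).app ∨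
      ∃ j, ∃ m' ≤ m, (G.node nb σ sch (m + 1) i).app =
        G.recv i j (G.node nb σ sch m i).app (G.pay (G.node nb σ sch m' j).app)) := by
  by_cases hi : sch m = i
  · cases hh : (G.node nb σ sch m i).hold with
    | none =>
      rw [node_succ_none G nb σ sch hi hh]
      exact Or.inr ⟨hi, Or.inl rfl⟩
    | some v =>
      rw [node_succ_some G nb σ sch hi hh]
      by_cases hb : (G.node nb σ sch m i).NewBit v (G.node nb σ sch m i).slot ∧
          (v (G.node nb σ sch m i).slot).2.1 = true
      · right
        refine ⟨hi, Or.inr ?_⟩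
        set d := (G.node nb σ sch m i).slot with hd
        set j := (nb d).symm i with hj
        have hji : nb d j = i := by simp [hj]
        have hl := linkInv G nb (σ := σ) (sch := sch) hne m j d
        rw [← hji] at hh hb
        obtain ⟨ht, hbit⟩ := hl.hold_recv v hh hb.1
        have hcnt := hl.cnt_of_ne (fun heq => hb.1.2.2 (ht.trans heq.symm))
        rw [hb.2] at hbit
        have hp := of_decide_eq_true hbit.symm
        obtain ⟨m', hm', hs⟩ := hl.sent
        refine ⟨j, m', hm', ?_⟩
        rw [hji] at hb hcnt
        simp only [handle, ← hd, hb, and_self, if_true, hcnt, hp, Encodable.encodek, ← hj, hs]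
      · left
        simp only [handle, hb, if_false]
  · exact Or.inl (by rw [node_succ_of_ne G nb σ sch hi])

/-! ### Liveness of the links between correct processes. -/

theorem node_eq_of_idle {m m' : ℕ} {i : Fin n} (hm : m ≤ m')
    (h : ∀ k, m ≤ k → k < m' → sch k ≠ i) : G.node nb σ sch m' i = G.node nb σ sch m i := by
  induction m', hm using Nat.le_induction with
  | base => rfl
  | succ m' hm' ih =>
    rw [node_succ_of_ne G nb σ sch (h m' hm' (by omega)), ih fun k h1 h2 => h k h1 (by omega)]

/-- The next step of a correct process. -/
theorem exists_next_step {i : Fin n} (hc : Correct sch i) (m : ℕ) :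
    ∃ m' ≥ m, sch m' = i ∧ G.node nb σ sch m' i = G.node nb σ sch m i := by
  classical
  have hex := hc m
  refine ⟨Nat.find hex, (Nat.find_spec hex).1, (Nat.find_spec hex).2, ?_⟩
  refine node_eq_of_idle G nb (Nat.find_spec hex).1 fun k h1 h2 h3 => ?_
  exact Nat.find_min hex h2 ⟨h1, h3⟩

/-- A process alternates reads and writes, and `ctr` grows by one with each write, so it passes
through every larger value. -/
theorem exists_read_step {i : Fin n} (hc : Correct sch i) (m : ℕ) (C : ℕ)
    (hC : (G.node nb σ sch m i).ctr < C) :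
    ∃ m' ≥ m, sch m' = i ∧ (G.node nb σ sch m' i).hold = none ∧
      (G.node nb σ sch m' i).ctr = C := by
  have hwrite : ∀ m, ∃ m' ≥ m, (G.node nb σ sch m' i).hold = none ∧
      (G.node nb σ sch m' i).ctr = (G.node nb σ sch m i).ctr + 1 := by
    have hsome : ∀ m v, (G.node nb σ sch m i).hold = some v →
        ∃ m' ≥ m, (G.node nb σ sch m' i).hold = none ∧
          (G.node nb σ sch m' i).ctr = (G.node nb σ sch m i).ctr + 1 := by
      intro m v hv
      obtain ⟨m₁, h1, h2, h3⟩ := exists_next_step G nb (σ := σ) hc m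
      refine ⟨m₁ + 1, by omega, ?_⟩
      rw [node_succ_some G nb σ sch h2 (v := v) (by rw [h3, hv]), h3]
      exact ⟨rfl, rfl⟩
    intro m
    cases hh : (G.node nb σ sch m i).hold with
    | some v => exact hsome m v hh
    | none =>
      obtain ⟨m₁, h1, h2, h3⟩ := exists_next_step G nb (σ := σ) hc m
      have hN := node_succ_none G nb σ sch h2 (by rw [h3, hh])
      obtain ⟨m', h4, h5, h6⟩ := hsome (m₁ + 1) _ (by rw [hN])
      exact ⟨m', by omega, h5, by rw [h6, hN, ← h3]⟩
  have key : ∀ C, (G.node nb σ sch m i).ctr < C → ∃ m' ≥ m, (G.node nb σ sch m' i).hold = none ∧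
      (G.node nb σ sch m' i).ctr = C := by
    intro C hC
    induction C, hC using Nat.le_induction with
    | base => exact hwrite m
    | succ C _ ih =>
      obtain ⟨m₁, h1, -, h3⟩ := ih
      obtain ⟨m', h4, h5, h6⟩ := hwrite m₁
      exact ⟨m', by omega, h5, by rw [h6, h3]⟩
  obtain ⟨m₁, h1, h2, h3⟩ := key C hC
  obtain ⟨m', h4, h5, h6⟩ := exists_next_step G nb (σ := σ) hc m₁
  exact ⟨m', by omega, h5, by rw [h6, h2], by rw [h6, h3]⟩

theorem exists_tick {i : Fin n} (hc : Correct sch i) (m : ℕ) :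
    ∃ m' ≥ m, (G.node nb σ sch (m' + 1) i).app = G.tick i (G.node nb σ sch m' i).app := by
  obtain ⟨m', h1, h2, h3, -⟩ := exists_read_step G nb (σ := σ) hc m _ (Nat.lt_succ_self _)
  exact ⟨m', h1, by rw [node_succ_none G nb σ sch h2 h3]⟩

/-- A correct process visits every link in both directions again and again. -/
theorem exists_visit {i : Fin n} (hc : Correct sch i) (m : ℕ) (d : Fin (b + 1)) (r : ℕ)
    (hr : r < 2) :
    ∃ m₁ ≥ m, ∃ m₂ > m₁, sch m₂ = i ∧ (G.node nb σ sch m₂ i).ctr % 2 = r ∧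
      (G.node nb σ sch m₂ i).slot = d ∧
      (G.node nb σ sch m₂ i).hold =
        some (G.node nb σ sch m₁ (if r = 0 then (nb d).symm i else nb d i)).ports ∧
      (G.node nb σ sch m₂ i).ack = (G.node nb σ sch m₁ i).ack ∧
      (G.node nb σ sch m₂ i).tog = (G.node nb σ sch m₁ i).tog := by
  -- The parity of `C` selects the direction and `C / 2` modulo `b + 1` selects the link; the
  -- multiple of `b + 1` only makes `C` exceed the present counter.
  set C := 2 * (((G.node nb σ sch m i).ctr + 1) * (b + 1) + d) + r with hC
  have hlt : (G.node nb σ sch m i).ctr < C := by nlinarith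
  obtain ⟨m₁, h1, h2, h3, h4⟩ := exists_read_step G nb (σ := σ) hc m C hlt
  have hN := node_succ_none G nb σ sch h2 h3
  obtain ⟨m₂, h5, h6, h7⟩ := exists_next_step G nb (σ := σ) hc (m₁ + 1)
  have hmod : (G.node nb σ sch m₁ i).ctr % 2 = r := by omega
  have hslot : (G.node nb σ sch m₁ i).slot = d := by
    have : (G.node nb σ sch m₁ i).ctr / 2 = ((G.node nb σ sch m i).ctr + 1) * (b + 1) + d := by
      omega
    apply Fin.ext
    rw [Node.slot, this, Fin.val_ofNat, Nat.mul_add_mod_self_right, Nat.mod_eq_of_lt d.2]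
  refine ⟨m₁, h1, m₂, by omega, h6, ?_, ?_, ?_, ?_, ?_⟩
  · rw [h7, hN]; exact hmod
  · rw [h7, hN]; exact hslot
  · rw [h7, hN]
    simp only [target, hmod, hslot]
  · rw [h7, hN]
  · rw [h7, hN]

/-- At step `m` process `i` advances its outgoing stream on link `d`. -/
def Advances (σ : Fin n → In) (sch : ℕ → Fin n) (m : ℕ) (i : Fin n) (d : Fin (b + 1)) : Prop :=
  sch m = i ∧ ∃ v, (G.node nb σ sch m i).hold = some v ∧ (G.node nb σ sch m i).Acked v d

theorem stream_eq_of_not_advances {m : ℕ} {i : Fin n} {d : Fin (b + 1)}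
    (h : ¬ G.Advances nb σ sch m i d) :
    (G.node nb σ sch (m + 1) i).msg d = (G.node nb σ sch m i).msg d ∧
    (G.node nb σ sch (m + 1) i).pos d = (G.node nb σ sch m i).pos d ∧
    (G.node nb σ sch (m + 1) i).tog d = (G.node nb σ sch m i).tog d := by
  by_cases hi : sch m = i
  · cases hh : (G.node nb σ sch m i).hold with
    | none => rw [node_succ_none G nb σ sch hi hh]; exact ⟨rfl, rfl, rfl⟩
    | some v =>
      have ha : ¬ (G.node nb σ sch m i).Acked v d := fun ha => h ⟨hi, v, hh, ha⟩
      rw [node_succ_some G nb σ sch hi hh]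
      simp [handle, ha]
  · rw [node_succ_of_ne G nb σ sch hi]; exact ⟨rfl, rfl, rfl⟩

variable (hne : ∀ d i, nb d i ≠ i)
include hne

/-- Once the acknowledgement equals the toggle, the receiver sees no new bit, so it keeps its
acknowledgement until the sender flips the toggle. -/
theorem acked_of_not_advances {m m' : ℕ} {i : Fin n} {d : Fin (b + 1)} (hm : m ≤ m')
    (h : ∀ k, m ≤ k → k < m' → ¬ G.Advances nb σ sch k i d)
    (ha : (G.node nb σ sch m (nb d i)).ack d = (G.node nb σ sch m i).tog d) :
    (G.node nb σ sch m' (nb d i)).ack d = (G.node nb σ sch m' i).tog d := by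
  induction m', hm using Nat.le_induction with
  | base => exact ha
  | succ m' hm' ih =>
    have ih := ih fun k h1 h2 => h k h1 (by omega)
    rw [(stream_eq_of_not_advances G nb (h m' hm' (by omega))).2.2, ← ih]
    by_cases hj : sch m' = nb d i
    · cases hh : (G.node nb σ sch m' (nb d i)).hold with
      | none => rw [node_succ_none G nb σ sch hj hh]
      | some v =>
        have hb : ¬ (G.node nb σ sch m' (nb d i)).NewBit v d := fun hb =>
          hb.2.2 ((((linkInv G nb hne m' i d).hold_recv v hh hb).1).trans ih.symm)
        rw [node_succ_some G nb σ sch hj hh]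
        simp [handle, hb]
    · rw [node_succ_of_ne G nb σ sch hj]

/-- At its next visit to the link the receiver either reads while the bit is already acknowledged,
or holds a new bit and acknowledges it with the following write. -/
theorem exists_acked {i : Fin n} {d : Fin (b + 1)} (hj : Correct sch (nb d i)) (m : ℕ) :
    ∃ m' ≥ m, (G.node nb σ sch m' (nb d i)).ack d = (G.node nb σ sch m' i).tog d := by
  obtain ⟨m₁, h1, m₂, h2, h3, h4, h5, h6, h7, -⟩ :=
    exists_visit G nb (σ := σ) hj m d 0 (by omega)
  simp only [if_true, Equiv.symm_apply_apply] at h6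
  by_cases ha : (G.node nb σ sch m₁ (nb d i)).ack d = (G.node nb σ sch m₁ i).tog d
  · exact ⟨m₁, h1, ha⟩
  · have hb : (G.node nb σ sch m₂ (nb d i)).NewBit (G.node nb σ sch m₁ i).ports d :=
      ⟨h4, h5, by rw [h7]; exact fun h => ha h.symm⟩
    have ht := ((linkInv G nb hne m₂ i d).hold_recv _ h6 hb).1
    refine ⟨m₂ + 1, by omega, ?_⟩
    rw [node_succ_some G nb σ sch h3 h6,
      node_succ_of_ne G nb σ sch (i := i) (by rw [h3]; exact hne d i), ← ht]
    simp [handle, hb]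

theorem exists_advances {i : Fin n} {d : Fin (b + 1)} (hi : Correct sch i)
    (hj : Correct sch (nb d i)) (m : ℕ) : ∃ m' ≥ m, G.Advances nb σ sch m' i d := by
  by_contra hno
  push Not at hno
  obtain ⟨m₀, h0, ha⟩ := exists_acked G nb (σ := σ) hne hj m
  obtain ⟨m₁, h1, m₂, h2, h3, h4, h5, h6, -, h8⟩ :=
    exists_visit G nb (σ := σ) hi m₀ d 1 (by omega)
  simp only [one_ne_zero, if_false] at h6
  refine hno m₂ (by omega) ⟨h3, _, h6, h4, h5, ?_⟩
  rw [h8]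
  exact acked_of_not_advances G nb hne h1 (fun k hk _ => hno k (by omega)) ha

/-- A correct process infinitely often finishes the transmission of a message to a correct
neighbour, and starts the transmission of its current payload. -/
theorem exists_load {i : Fin n} {d : Fin (b + 1)} (hi : Correct sch i)
    (hj : Correct sch (nb d i)) (m : ℕ) : ∃ m' ≥ m, G.Advances nb σ sch m' i d ∧
      (G.node nb σ sch m' i).pos d = Encodable.encode ((G.node nb σ sch m' i).msg d) ∧
      (G.node nb σ sch m' i).msg d = (G.node nb σ sch m i).msg d := by
  classical
  -- Induction on the number of zeros of the current message that are still to be acknowledged.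
  generalize hN : Encodable.encode ((G.node nb σ sch m i).msg d) - (G.node nb σ sch m i).pos d = N
  induction N generalizing m with
  | zero | succ N ih =>
    have hex := exists_advances G nb (σ := σ) hne hi hj m
    set m₁ := Nat.find hex with hm₁
    obtain ⟨hge, hadv⟩ := Nat.find_spec hex
    rw [← hm₁] at hge hadv
    have hconst : (G.node nb σ sch m₁ i).msg d = (G.node nb σ sch m i).msg d ∧
        (G.node nb σ sch m₁ i).pos d = (G.node nb σ sch m i).pos d := by
      have : ∀ k, m ≤ k → k ≤ m₁ → (G.node nb σ sch k i).msg d = (G.node nb σ sch m i).msg d ∧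
          (G.node nb σ sch k i).pos d = (G.node nb σ sch m i).pos d := by
        intro k hk
        induction k, hk using Nat.le_induction with
        | base => exact fun _ => ⟨rfl, rfl⟩
        | succ k hk ihk =>
          intro hk2
          have hna : ¬ G.Advances nb σ sch k i d := fun h =>
            Nat.find_min hex (m := k) (by omega) ⟨hk, h⟩
          obtain ⟨h1, h2, -⟩ := stream_eq_of_not_advances G nb hna
          obtain ⟨h3, h4⟩ := ihk (by omega)
          exact ⟨h1.trans h3, h2.trans h4⟩
      exact this m₁ hge le_rfl
    have hle := (linkInv G nb (σ := σ) (sch := sch) hne m₁ i d).pos_le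
    by_cases hp : (G.node nb σ sch m₁ i).pos d = Encodable.encode ((G.node nb σ sch m₁ i).msg d)
    · exact ⟨m₁, hge, hadv, hp, hconst.1⟩
    · first
      | exact absurd (le_antisymm hle (by rw [hconst.1, hconst.2]; omega)) hp
      | obtain ⟨hs, v, hv, hack⟩ := hadv
        have hN1 := node_succ_some G nb σ sch hs hv
        have e1 : (G.node nb σ sch (m₁ + 1) i).msg d = (G.node nb σ sch m₁ i).msg d := by
          rw [hN1]; simp [handle, hp]
        have e2 : (G.node nb σ sch (m₁ + 1) i).pos d = (G.node nb σ sch m₁ i).pos d + 1 := by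
          rw [hN1]; simp [handle, hp, hack]
        obtain ⟨m', h1, h2, h3, h4⟩ := ih (m₁ + 1) (by rw [e1, e2, hconst.1, hconst.2]; omega)
        exact ⟨m', by omega, h2, h3, h4.trans (e1.trans hconst.1)⟩

/-- Every payload of a correct process is eventually superseded by a payload that is delivered to
a correct neighbour. -/
theorem exists_delivery {i : Fin n} {d : Fin (b + 1)} (hi : Correct sch i)
    (hj : Correct sch (nb d i)) (m : ℕ) : ∃ m' ≥ m, ∃ m₀,
      (G.node nb σ sch (m₀ + 1) (nb d i)).app =
        G.recv (nb d i) i (G.node nb σ sch m₀ (nb d i)).app (G.pay (G.node nb σ sch m' i).app) := by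
  obtain ⟨m₁, h1, ⟨hs, v, hv, hack⟩, h3, -⟩ := exists_load G nb (σ := σ) hne hi hj m
  have hmsg : (G.node nb σ sch (m₁ + 1) i).msg d = G.pay (G.node nb σ sch m₁ i).app := by
    rw [node_succ_some G nb σ sch hs hv]; simp [handle, hack, h3]
  -- The first completed transmission loads the payload; the second one completes the transmission
  -- of that payload, which is thus delivered.
  obtain ⟨m₂, h4, ⟨hs2, v2, hv2, hack2⟩, h5, h6⟩ := exists_load G nb (σ := σ) hne hi hj (m₁ + 1)
  have hl := linkInv G nb (σ := σ) (sch := sch) hne m₂ i d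
  obtain ⟨m₀, h7⟩ := hl.delivered (hl.hold_send v2 hv2 hack2) h5
  exact ⟨m₁, h1, m₀, by rw [h7, h6, hmsg]⟩

end Run

end Protocol

end SharedMemory

/-! ### Quorum emulation of unbounded registers. -/

namespace SharedMemory

variable {n : ℕ} {In : Type u} {Out : Type v}

/-- The phases of an emulated operation: not yet announced, announced (waiting for a quorum), and,
for a read, writing back the entry `k` that will be returned. -/
inductive Phase : Type
  | idle
  | query
  | back (k : ℕ)

/-- The state of a process that emulates an algorithm by quorums. An entry of a process is a natural
number `Nat.pair a v`, where `v` is the emulated content of its register. `know p q` is the largest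
entry of `q` that `p` is known to have known. -/
structure Emu (n : ℕ) (S : Type) where
  know : Fin n → Fin n → ℕ
  loc : S
  prev : ℕ
  phase : Phase
  done : ℕ

/-- The register content of an entry. -/
def entryVal (e : ℕ) : ℕ := (Nat.unpair e).2

/-- Process `i` issues a new entry with value `v`. -/
def bump (i : Fin n) (K : Fin n → Fin n → ℕ) (v : ℕ) : Fin n → Fin n → ℕ :=
  fun p q => if p = i ∧ q = i then Nat.pair (K i i + 1) v else K p q

/-- Process `i` combines its knowledge `K` with the knowledge `L` of process `j`. -/
def merge (i j : Fin n) (K L : Fin n → Fin n → ℕ) : Fin n → Fin n → ℕ :=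
  fun p q => if p = i then max (K i q) (L j q) else max (K p q) (L p q)

/-- At least `n - t` processes are known by `i` to know the latest entry of `i`. -/
def Quorum (t : ℕ) (i : Fin n) (K : Fin n → Fin n → ℕ) : Prop :=
  n - t ≤ (Finset.univ.filter fun p => K i i ≤ K p i).card

/-- `Nat.pair a v` is at least `a`, so taking the old entry plus one as first component makes the
new entry larger whatever its value. One number thus serves as timestamp and content. -/
theorem lt_bump (i : Fin n) (K : Fin n → Fin n → ℕ) (v : ℕ) : K i i < bump i K v i i := by
  simp only [bump, and_self, if_true]
  exact lt_of_lt_of_le (Nat.lt_succ_self _) (Nat.left_le_pair _ _)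

theorem le_bump (i : Fin n) (K : Fin n → Fin n → ℕ) (v : ℕ) : K ≤ bump i K v := by
  intro p q
  by_cases h : p = i ∧ q = i
  · obtain ⟨rfl, rfl⟩ := h
    exact (lt_bump _ K v).le
  · simp [bump, h]

theorem le_merge (i j : Fin n) (K L : Fin n → Fin n → ℕ) : K ≤ merge i j K L := by
  intro p q
  by_cases h : p = i
  · subst h; simp [merge]
  · simp [merge, h]

namespace Algorithm

variable (A : Algorithm n ℕ In Out) (t : ℕ)

open scoped Classical in
/-- The local progress of the emulation. -/
noncomputable def emuTick (i : Fin n) (s : Emu n A.State) : Emu n A.State :=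
  match s.phase with
  | Phase.idle =>
    { s with
      -- A read also issues an entry, repeating the old value: its stamp reveals which processes
      -- have answered since the query began.
      know := bump i s.know (match A.op i s.loc with
        | Op.read _ _ => entryVal (s.know i i)
        | Op.write w _ => w)
      prev := s.know i i
      phase := Phase.query }
  | Phase.query =>
    if Quorum t i s.know then
      (match A.op i s.loc with
      | Op.read j _ =>
        { s with
          know := bump i s.know (entryVal (s.know i i))
          prev := s.know i i
          phase := Phase.back (s.know i j) }
      | Op.write _ s' => { s with loc := s', phase := Phase.idle, done := s.done + 1 })
    else s
  | Phase.back k =>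
    if Quorum t i s.know then
      (match A.op i s.loc with
      | Op.read _ κ => { s with loc := κ (entryVal k), phase := Phase.idle, done := s.done + 1 }
      -- A default that never arises in an emulation: by `back_spec` only reads reach this phase.
      | Op.write _ _ => s)
    else s

/-- The possible effects of a local step of the emulation. -/
inductive EmuStep (i : Fin n) (s : Emu n A.State) : Emu n A.State → Prop
  | stay : EmuStep i s s
  | start (v : ℕ) (hp : s.phase = Phase.idle)
      (hr : ∀ j κ, A.op i s.loc = Op.read j κ → v = entryVal (s.know i i))
      (hw : ∀ w s', A.op i s.loc = Op.write w s' → v = w) :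
      EmuStep i s { s with know := bump i s.know v, prev := s.know i i, phase := Phase.query }
  | turn (j : Fin n) (κ : ℕ → A.State) (hp : s.phase = Phase.query)
      (hop : A.op i s.loc = Op.read j κ) (hq : Quorum t i s.know) :
      EmuStep i s
        { s with
          know := bump i s.know (entryVal (s.know i i))
          prev := s.know i i
          phase := Phase.back (s.know i j) }
  | finishWrite (w : ℕ) (s' : A.State) (hp : s.phase = Phase.query)
      (hop : A.op i s.loc = Op.write w s') (hq : Quorum t i s.know) :
      EmuStep i s { s with loc := s', phase := Phase.idle, done := s.done + 1 }
  | finishRead (k : ℕ) (j : Fin n) (κ : ℕ → A.State) (hp : s.phase = Phase.back k)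
      (hop : A.op i s.loc = Op.read j κ) (hq : Quorum t i s.know) :
      EmuStep i s { s with loc := κ (entryVal k), phase := Phase.idle, done := s.done + 1 }

theorem emuStep_emuTick (i : Fin n) (s : Emu n A.State) :
    A.EmuStep t i s (A.emuTick t i s) := by
  unfold emuTick
  cases hp : s.phase with
  | idle =>
    refine EmuStep.start _ hp ?_ ?_
    · intro j κ h; simp [h]
    · intro w s' h; simp [h]
  | query =>
    by_cases hq : Quorum t i s.know
    · cases hop : A.op i s.loc with
      | read j κ => simpa [hq] using EmuStep.turn j κ hp hop hq
      | write w s' => simpa [hq] using EmuStep.finishWrite w s' hp hop hq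
    · simpa [hq] using EmuStep.stay
  | back k =>
    by_cases hq : Quorum t i s.know
    · cases hop : A.op i s.loc with
      | read j κ => simpa [hq] using EmuStep.finishRead k j κ hp hop hq
      | write w s' => simpa [hq] using EmuStep.stay
    · simpa [hq] using EmuStep.stay

/-- The initial state of the emulation. -/
def emuStart (i : Fin n) (x : In) : Emu n A.State where
  know := fun _ q => Nat.pair 0 (A.regInit q)
  loc := A.start i x
  prev := Nat.pair 0 (A.regInit i)
  phase := Phase.idle
  done := 0

/-- An execution of the emulation. -/
structure IsEmu (σ : Fin n → In) (a : ℕ → Fin n → Emu n A.State) : Prop where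
  zero : ∀ i, a 0 i = A.emuStart i (σ i)
  succ : ∀ m i, A.EmuStep t i (a m i) (a (m + 1) i) ∨ ∃ j, ∃ m' ≤ m,
    a (m + 1) i = { a m i with know := merge i j (a m i).know (a m' j).know }

variable {A t} {σ : Fin n → In} {a : ℕ → Fin n → Emu n A.State}

namespace IsEmu

/-! ### Soundness and causality of the flooded knowledge. -/

section Knowledge

variable (h : A.IsEmu t σ a)
include h

theorem know_succ (m : ℕ) (i : Fin n) :
    ((a (m + 1) i).know = (a m i).know ∧ (a (m + 1) i).prev = (a m i).prev) ∨
    (∃ v, (a (m + 1) i).know = bump i (a m i).know v ∧ (a (m + 1) i).prev = (a m i).know i i ∧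
      ((a m i).phase = Phase.idle ∨ Quorum t i (a m i).know)) ∨
    (∃ j, ∃ m' ≤ m, (a (m + 1) i).know = merge i j (a m i).know (a m' j).know ∧
      (a (m + 1) i).prev = (a m i).prev) := by
  rcases h.succ m i with hs | ⟨j, m', hm', hs⟩
  · generalize a (m + 1) i = s' at hs ⊢
    cases hs with
    | stay => exact Or.inl ⟨rfl, rfl⟩
    | start v hp => exact Or.inr (Or.inl ⟨v, rfl, rfl, Or.inl hp⟩)
    | turn j κ hp hop hq => exact Or.inr (Or.inl ⟨_, rfl, rfl, Or.inr hq⟩)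
    | finishWrite => exact Or.inl ⟨rfl, rfl⟩
    | finishRead => exact Or.inl ⟨rfl, rfl⟩
  · exact Or.inr (Or.inr ⟨j, m', hm', by rw [hs], by rw [hs]⟩)

theorem know_mono {m m' : ℕ} (hm : m ≤ m') (i : Fin n) : (a m i).know ≤ (a m' i).know := by
  induction m', hm using Nat.le_induction with
  | base => exact le_rfl
  | succ m' _ ih =>
    refine ih.trans ?_
    rcases h.know_succ m' i with ⟨hk, -⟩ | ⟨v, hk, -⟩ | ⟨j, m₁, -, hk, -⟩ <;> rw [hk]
    · exact le_bump _ _ _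
    · exact le_merge _ _ _ _

theorem know_mono_apply {m m' : ℕ} (hm : m ≤ m') (i p q : Fin n) :
    (a m i).know p q ≤ (a m' i).know p q :=
  h.know_mono hm i p q

/-- What `i` knows about `p` is what `p` knew at some earlier time, and it is known to `i`. -/
theorem know_sound (m : ℕ) (i p : Fin n) :
    (∃ m' ≤ m, (a m i).know p = (a m' p).know p) ∧ (a m i).know p ≤ (a m i).know i := by
  induction m using Nat.strong_induction_on generalizing i p with
  | _ m ih =>
  by_cases hpi : p = i
  · subst hpi; exact ⟨⟨m, le_rfl, rfl⟩, le_rfl⟩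
  cases m with
  | zero => exact ⟨⟨0, le_rfl, by simp [h.zero, emuStart]⟩, by simp [h.zero, emuStart]⟩
  | succ m =>
    obtain ⟨⟨m₁, hm₁, h₁⟩, hle⟩ := ih m (Nat.lt_succ_self m) i p
    have hle' := hle.trans (h.know_mono (Nat.le_succ m) i i)
    rcases h.know_succ m i with ⟨hk, -⟩ | ⟨v, hk, -⟩ | ⟨j, m', hm', hk, -⟩
    · have : (a (m + 1) i).know p = (a m i).know p := by rw [hk]
      exact ⟨⟨m₁, by omega, this.trans h₁⟩, this.le.trans hle'⟩
    · have : (a (m + 1) i).know p = (a m i).know p := by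
        rw [hk]; funext q; simp [bump, hpi]
      exact ⟨⟨m₁, by omega, this.trans h₁⟩, this.le.trans hle'⟩
    · obtain ⟨⟨m₂, hm₂, h₂⟩, hle₂⟩ := ih m' (by omega) j p
      constructor
      · refine ⟨max m₁ m₂, by omega, ?_⟩
        funext q
        rw [hk]
        simp only [merge, hpi, if_false, h₁, h₂]
        rcases le_total m₁ m₂ with h12 | h12
        · rw [max_eq_right h12, max_eq_right (h.know_mono h12 p p q)]
        · rw [max_eq_left h12, max_eq_left (h.know_mono h12 p p q)]
      · intro q
        rw [hk]
        simp only [merge, hpi, if_false, if_true]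
        exact max_le_max (hle q) (hle₂ q)

theorem know_le (m : ℕ) (i p : Fin n) : (a m i).know p ≤ (a m p).know p := by
  obtain ⟨⟨m', hm', hk⟩, -⟩ := h.know_sound m i p
  rw [hk]
  exact h.know_mono hm' p p

/-- The time bound is `m` and not `m + 1`: news about `j` reaches others only from earlier states,
so an entry issued in this step is still private. `not_known_of_lt` rests on this delay. -/
theorem exists_entry_succ (m : ℕ)
    (ih : ∀ m' ≤ m, ∀ p j, ∃ m₁ ≤ m', (a m' p).know p j = (a m₁ j).know j j)
    {p j : Fin n} (hpj : p ≠ j) :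
    ∃ m' ≤ m, (a (m + 1) p).know p j = (a m' j).know j j := by
  obtain ⟨m₁, hm₁, h₁⟩ := ih m le_rfl p j
  rcases h.know_succ m p with ⟨hk, -⟩ | ⟨v, hk, -⟩ | ⟨q, m', hm', hk, -⟩
  · exact ⟨m₁, hm₁, by rw [hk, h₁]⟩
  · exact ⟨m₁, hm₁, by rw [hk, ← h₁]; simp [bump, hpj.symm]⟩
  · obtain ⟨m₂, hm₂, h₂⟩ := ih m' hm' q j
    rw [hk]
    simp only [merge, if_true]
    rcases le_total ((a m p).know p j) ((a m' q).know q j) with h12 | h12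
    · exact ⟨m₂, by omega, by rw [max_eq_right h12, h₂]⟩
    · exact ⟨m₁, by omega, by rw [max_eq_left h12, h₁]⟩

theorem exists_entry (m : ℕ) (p j : Fin n) :
    ∃ m' ≤ m, (a m p).know p j = (a m' j).know j j := by
  induction m using Nat.strong_induction_on generalizing p j with
  | _ m ih =>
  by_cases hpj : p = j
  · subst hpj; exact ⟨m, le_rfl, rfl⟩
  cases m with
  | zero => exact ⟨0, le_rfl, by simp [h.zero, emuStart]⟩
  | succ m =>
    obtain ⟨m', hm', hk⟩ := h.exists_entry_succ m (fun m' hm' => ih m' (by omega)) hpj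
    exact ⟨m', by omega, hk⟩

theorem know_le_own (m : ℕ) (p j : Fin n) : (a m p).know p j ≤ (a m j).know j j := by
  obtain ⟨m', hm', hk⟩ := h.exists_entry m p j
  rw [hk]
  exact h.know_mono hm' j j j

theorem know_succ_le_own (m : ℕ) {p j : Fin n} (hpj : p ≠ j) :
    (a (m + 1) p).know p j ≤ (a m j).know j j := by
  obtain ⟨m', hm', hk⟩ := h.exists_entry_succ m (fun m' _ => h.exists_entry m') hpj
  rw [hk]
  exact h.know_mono hm' j j j

/-- Nobody knows a later entry of `i` than `i` itself. -/
theorem merge_own {m m' : ℕ} (hm : m' ≤ m) (i j : Fin n) :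
    merge i j (a m i).know (a m' j).know i i = (a m i).know i i := by
  simp only [merge, if_true]
  exact max_eq_left ((h.know_le_own m' j i).trans (h.know_mono hm i i i))

theorem own_succ (m : ℕ) (i : Fin n) :
    ((a (m + 1) i).know i i = (a m i).know i i ∧ (a (m + 1) i).prev = (a m i).prev) ∨
    ((a m i).know i i < (a (m + 1) i).know i i ∧ (a (m + 1) i).prev = (a m i).know i i ∧
      ((a m i).phase = Phase.idle ∨ Quorum t i (a m i).know)) := by
  rcases h.know_succ m i with ⟨hk, hp⟩ | ⟨v, hk, hp⟩ | ⟨j, m', hm', hk, hp⟩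
  · exact Or.inl ⟨by rw [hk], hp⟩
  · exact Or.inr ⟨by rw [hk]; exact lt_bump _ _ _, hp⟩
  · exact Or.inl ⟨by rw [hk, h.merge_own hm'], hp⟩

/-- Whoever knows an entry of `i` knows everything that `i` knew when it issued the entry. -/
theorem causal {s : ℕ} {i : Fin n} (hs : (a s i).know i i < (a (s + 1) i).know i i) (m : ℕ)
    (p : Fin n) (hm : (a (s + 1) i).know i i ≤ (a m p).know p i) :
    (a (s + 1) i).know i ≤ (a m p).know p := by
  induction m using Nat.strong_induction_on generalizing p with
  | _ m ih =>
  by_cases hpi : p = i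
  · subst hpi
    have : s + 1 ≤ m := by
      by_contra hlt
      have := h.know_mono_apply (show m ≤ s by omega) p p p
      omega
    exact h.know_mono this p p
  cases m with
  | zero =>
    have h1 := h.know_le_own 0 p i
    have h2 := h.know_mono_apply (Nat.zero_le s) i i i
    omega
  | succ m =>
    rcases h.know_succ m p with ⟨hk, -⟩ | ⟨v, hk, -⟩ | ⟨q, m', hm', hk, -⟩
    · rw [hk] at hm ⊢
      exact ih m (by omega) p hm
    · refine (ih m (by omega) p ?_).trans (h.know_mono (Nat.le_succ m) p p)
      rw [hk] at hm
      simpa [bump, Ne.symm hpi] using hm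
    · rw [hk] at hm ⊢
      simp only [merge, if_true, le_max_iff] at hm
      intro r
      simp only [merge, if_true, le_max_iff]
      rcases hm with hm | hm
      · exact Or.inl (ih m (by omega) p hm r)
      · exact Or.inr (ih m' (by omega) q hm r)

/-- `prev` is the immediate predecessor of the current entry: `j` never holds an entry strictly
between them. -/
theorem own_le_prev {m m' : ℕ} {j : Fin n} (hlt : (a m' j).know j j < (a m j).know j j) :
    (a m' j).know j j ≤ (a m j).prev := by
  induction m with
  | zero => exact absurd (h.know_mono (Nat.zero_le m') j j j) (not_le.2 hlt)
  | succ m ih =>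
    rcases h.own_succ m j with ⟨h1, h2⟩ | ⟨h1, h2, -⟩
    · rw [h2]; exact ih (by omega)
    · rw [h2]
      have : m' ≤ m := by
        by_contra hc
        exact absurd (h.know_mono (show m + 1 ≤ m' by omega) j j j) (not_le.2 hlt)
      exact h.know_mono this j j j

end Knowledge

end IsEmu

/-- At time `m` at least `n - t` processes know of process `j` the entry `k` or a later one. -/
def Known (t : ℕ) (a : ℕ → Fin n → Emu n A.State) (k : ℕ) (j : Fin n) (m : ℕ) : Prop :=
  n - t ≤ (Finset.univ.filter fun p => k ≤ (a m p).know p j).card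

open scoped Classical in
/-- The latest entry of process `j` that is known to `n - t` processes at time `m`. -/
noncomputable def committed (t : ℕ) (a : ℕ → Fin n → Emu n A.State) (j : Fin n) (m : ℕ) : ℕ :=
  if Known t a ((a m j).know j j) j m then (a m j).know j j else (a m j).prev

namespace IsEmu

/-! ### Committed entries and the two bounds on the result of a read. -/

section Commit

variable (h : A.IsEmu t σ a)
include h

theorem known_mono {k : ℕ} {j : Fin n} {m m' : ℕ} (hm : m ≤ m') (hk : Known t a k j m) :
    Known t a k j m' :=
  hk.trans (Finset.card_le_card (Finset.monotone_filter_right _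
    fun p _ hp => hp.trans (h.know_mono hm p p j)))

theorem known_of_quorum {i : Fin n} {m : ℕ} (hq : Quorum t i (a m i).know) :
    Known t a ((a m i).know i i) i m :=
  hq.trans (Finset.card_le_card (Finset.monotone_filter_right _
    fun p _ hp => hp.trans (h.know_le m i p i)))

/-- A process issues an entry only when idle or after seeing a quorum for its current one, and it
becomes idle only after seeing a quorum. The two claims support each other in the induction. -/
theorem known_prev_and (m : ℕ) (j : Fin n) : Known t a (a m j).prev j m ∧
    ((a m j).phase = Phase.idle → Known t a ((a m j).know j j) j m) := by
  induction m with
  | zero => simp [Known, h.zero, emuStart]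
  | succ m ih =>
    have hcase : (a m j).phase = Phase.idle ∨ Quorum t j (a m j).know →
        Known t a ((a m j).know j j) j m := by
      rintro (hp | hq)
      · exact ih.2 hp
      · exact h.known_of_quorum hq
    constructor
    · apply h.known_mono (Nat.le_succ m)
      rcases h.own_succ m j with ⟨-, h2⟩ | ⟨-, h2, h3⟩
      · rw [h2]; exact ih.1
      · rw [h2]; exact hcase h3
    · intro hidle
      apply h.known_mono (Nat.le_succ m)
      rcases h.succ m j with hs | ⟨q, m', hm', hs⟩
      · generalize a (m + 1) j = s' at hs hidle ⊢
        cases hs with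
        | stay => exact ih.2 hidle
        | start v hp => exact absurd hidle (by simp)
        | turn q κ hp hop hq => exact absurd hidle (by simp)
        | finishWrite w s' hp hop hq => exact hcase (Or.inr hq)
        | finishRead k q κ hp hop hq => exact hcase (Or.inr hq)
      · rw [hs] at hidle ⊢
        simp only [h.merge_own hm']
        exact ih.2 hidle

theorem known_committed (j : Fin n) (m : ℕ) : Known t a (committed t a j m) j m := by
  unfold committed
  split_ifs with hk
  · exact hk
  · exact (h.known_prev_and m j).1

/-- If `k` exceeded `prev`, every process that knows `k` or a later entry would know the current
entry, as nothing lies between; the current entry would then be known to a quorum. -/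
theorem le_committed (ht : t < n) {k : ℕ} {j : Fin n} {m : ℕ} (hk : Known t a k j m) :
    k ≤ committed t a j m := by
  unfold committed
  split_ifs with hc
  · have hpos : 0 < (Finset.univ.filter fun p => k ≤ (a m p).know p j).card :=
      lt_of_lt_of_le (by omega) hk
    obtain ⟨p, hp⟩ := Finset.card_pos.1 hpos
    exact (Finset.mem_filter.1 hp).2.trans (h.know_le_own m p j)
  · by_contra hlt
    refine hc (hk.trans (Finset.card_le_card (Finset.monotone_filter_right _ fun p _ hp => ?_)))
    by_contra hlt2
    obtain ⟨m', -, he⟩ := h.exists_entry m p j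
    have := h.own_le_prev (m := m) (m' := m') (j := j) (by omega)
    omega

theorem prev_succ_le (ht : t < n) (j : Fin n) (m : ℕ) :
    (a (m + 1) j).prev ≤ committed t a j m := by
  apply h.le_committed ht
  rcases h.own_succ m j with ⟨-, h2⟩ | ⟨-, h2, hp | hq⟩
  · rw [h2]; exact (h.known_prev_and m j).1
  · rw [h2]; exact (h.known_prev_and m j).2 hp
  · rw [h2]; exact h.known_of_quorum hq

/-- The committed entry does not skip any entry. -/
theorem committed_succ_eq (ht : t < n) {j : Fin n} {m m' : ℕ}
    (h1 : committed t a j m < (a m' j).know j j)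
    (h2 : (a m' j).know j j ≤ committed t a j (m + 1)) :
    committed t a j (m + 1) = (a m' j).know j j := by
  have hp := h.prev_succ_le ht j m
  by_contra hne
  have hlt : (a m' j).know j j < committed t a j (m + 1) := lt_of_le_of_ne h2 (Ne.symm hne)
  unfold committed at hlt
  split_ifs at hlt with hc
  · have := h.own_le_prev hlt
    omega
  · omega

/-- A freshly issued entry is not committed. -/
theorem not_known_of_lt (ht : t + 1 < n) {j : Fin n} {m : ℕ}
    (hlt : (a m j).know j j < (a (m + 1) j).know j j) :
    ¬ Known t a ((a (m + 1) j).know j j) j (m + 1) := by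
  intro hk
  have : (Finset.univ.filter fun p => (a (m + 1) j).know j j ≤ (a (m + 1) p).know p j).card ≤ 1 := by
    refine (Finset.card_le_card fun p hp => ?_).trans_eq (Finset.card_singleton j)
    rw [Finset.mem_singleton]
    by_contra hpj
    have h1 := (Finset.mem_filter.1 hp).2
    have h2 := h.know_succ_le_own m hpj
    omega
  have := hk.trans this
  omega

/-- Before a read operation is announced, the committed entry is at most the entry that the
operation returns. -/
theorem committed_le_result (ht : 2 * t < n) {i j : Fin n} {κ : ℕ → A.State} {m e : ℕ}
    (hop : A.op i (a m i).loc = Op.read j κ) (hidle : (a m i).phase = Phase.idle) (hme : m ≤ e)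
    (hdone : (a e i).done = (a m i).done) : (a e i).loc = (a m i).loc ∧
      ((a e i).phase = Phase.query → ∃ s, m ≤ s ∧ (a s i).know i i < (a (s + 1) i).know i i ∧
        (a (s + 1) i).know i i = (a e i).know i i) ∧
      ∀ k, (a e i).phase = Phase.back k → committed t a j m ≤ k := by
  have hdmono : ∀ e, (a e i).done ≤ (a (e + 1) i).done := by
    intro e
    rcases h.succ e i with hs | ⟨q, m', hm', hs⟩
    · generalize a (e + 1) i = s' at hs ⊢
      cases hs <;> simp
    · rw [hs]
  have hdmono' : ∀ e, m ≤ e → (a m i).done ≤ (a e i).done := by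
    intro e he
    induction e, he using Nat.le_induction with
    | base => exact le_rfl
    | succ e _ ih => exact ih.trans (hdmono e)
  induction e, hme using Nat.le_induction with
  | base => exact ⟨rfl, by simp [hidle], by simp [hidle]⟩
  | succ e hme ih =>
    have hd : (a e i).done = (a m i).done :=
      le_antisymm (hdone ▸ hdmono e) (hdmono' e hme)
    obtain ⟨ih1, ih2, ih3⟩ := ih hd
    rcases h.succ e i with hs | ⟨q, m', hm', hs⟩
    · have hown := h.own_succ e i
      generalize hs' : a (e + 1) i = s' at hs hdone hown ⊢
      cases hs with
      | stay => exact ⟨ih1, ih2, ih3⟩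
      | start v hp hr hw =>
        refine ⟨ih1, fun _ => ⟨e, hme, ?_, ?_⟩, by simp⟩
        · rw [hs']; exact lt_bump _ _ _
        · rw [hs']
      | turn j' κ' hp hop' hq =>
        refine ⟨ih1, by simp, ?_⟩
        intro k hk
        simp only [Phase.back.injEq] at hk
        rw [ih1, hop] at hop'
        simp only [Op.read.injEq] at hop'
        rw [← hk, ← hop'.1]
        obtain ⟨s, hms, hlt, hse⟩ := ih2 hp
        -- Two sets of `n - t` processes meet because `2 * t < n`: some `p` knew the committed entry
        -- at time `m` and is known by `i` to have seen the query.
        have hQ := h.known_committed j m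
        obtain ⟨p, hp⟩ := Finset.inter_nonempty_of_card_lt_card_add_card
          (Finset.subset_univ _) (Finset.subset_univ _)
          (lt_of_lt_of_le (by rw [Finset.card_univ, Fintype.card_fin]; omega) (add_le_add hQ hq))
        rw [Finset.mem_inter, Finset.mem_filter, Finset.mem_filter] at hp
        obtain ⟨⟨-, hp1⟩, -, hp2⟩ := hp
        obtain ⟨⟨mp, hmp, hkp⟩, hle⟩ := h.know_sound e i p
        -- What `i` knows about `p` dates from after the query was issued, hence from after time
        -- `m`.
        have hsm : s ≤ mp := by
          by_contra hc
          have h1 := h.know_mono_apply (show mp ≤ s by omega) p p i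
          have h2 := h.know_le_own s p i
          rw [hkp] at hp2
          omega
        calc committed t a j m ≤ (a m p).know p j := hp1
          _ ≤ (a mp p).know p j := h.know_mono (by omega) p p j
          _ = (a e i).know p j := by rw [hkp]
          _ ≤ (a e i).know i j := hle j
      | finishWrite w s' hp hop' hq => simp at hdone; omega
      | finishRead k j' κ' hp hop' hq => simp at hdone; omega
    · rw [hs]
      refine ⟨ih1, ?_, ih3⟩
      simp only [h.merge_own hm']
      exact ih2

/-- In the write-back phase of a read. -/
theorem back_spec {i : Fin n} {m k : ℕ} (hk : (a m i).phase = Phase.back k) :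
    ∃ j κ, A.op i (a m i).loc = Op.read j κ ∧ (∃ m', k = (a m' j).know j j) ∧
      ∃ e, (a e i).know i i < (a (e + 1) i).know i i ∧
        (a (e + 1) i).know i i = (a m i).know i i ∧ k ≤ (a (e + 1) i).know i j := by
  induction m with
  | zero => simp [h.zero, emuStart] at hk
  | succ m ih =>
    rcases h.succ m i with hs | ⟨q, m', hm', hs⟩
    · generalize hs' : a (m + 1) i = s' at hs hk ⊢
      cases hs with
      | stay => exact ih hk
      | start v hp hr hw => simp at hk
      | turn j κ hp hop hq =>
        simp only [Phase.back.injEq] at hk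
        refine ⟨j, κ, hop, ?_, m, ?_, ?_, ?_⟩
        · obtain ⟨m', -, h'⟩ := h.exists_entry m i j
          exact ⟨m', hk ▸ h'⟩
        · rw [hs']; exact lt_bump _ _ _
        · rw [hs']
        · rw [← hk]; exact h.know_mono (Nat.le_succ m) i i j
      | finishWrite => simp at hk
      | finishRead => simp at hk
    · rw [hs] at hk ⊢
      simp only [h.merge_own hm']
      exact ih hk

/-- The write-back entry was issued when `i` already knew `k`. By `causal`, the quorum that knows
this entry also knows `k`. -/
theorem result_le_committed (ht : t < n) {i j : Fin n} {κ : ℕ → A.State} {m k : ℕ}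
    (hk : (a m i).phase = Phase.back k) (hop : A.op i (a m i).loc = Op.read j κ)
    (hq : Quorum t i (a m i).know) : k ≤ committed t a j m := by
  obtain ⟨j', κ', hop', -, e, h1, h2, h3⟩ := h.back_spec hk
  rw [hop] at hop'
  simp only [Op.read.injEq] at hop'
  obtain ⟨rfl, -⟩ := hop'
  apply h.le_committed ht
  refine hq.trans (Finset.card_le_card (Finset.monotone_filter_right _ fun p _ hp => ?_))
  rw [← h2] at hp
  exact h3.trans (h.causal h1 m p (hp.trans (h.know_le m i p i)) j)

theorem entryVal_own {i : Fin n} {m : ℕ} (hp : (a m i).phase ≠ Phase.idle) :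
    (∀ w s', A.op i (a m i).loc = Op.write w s' → entryVal ((a m i).know i i) = w) ∧
    (∀ j κ, A.op i (a m i).loc = Op.read j κ →
      entryVal ((a m i).know i i) = entryVal (a m i).prev) := by
  induction m with
  | zero => simp [h.zero, emuStart] at hp
  | succ m ih =>
    rcases h.succ m i with hs | ⟨q, m', hm', hs⟩
    · generalize a (m + 1) i = s' at hs hp ⊢
      cases hs with
      | stay => exact ih hp
      | start v _ hr hw =>
        refine ⟨fun w s' hop => ?_, fun j κ hop => ?_⟩
        · simpa [bump, entryVal] using hw w s' hop
        · simpa [bump, entryVal] using hr j κ hop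
      | turn j κ _ hop hq =>
        refine ⟨fun w s' hop' => ?_, fun j κ hop => ?_⟩
        · rw [hop] at hop'; simp at hop'
        · simp [bump, entryVal]
      | finishWrite => simp at hp
      | finishRead => simp at hp
    · rw [hs] at hp ⊢
      simp only [h.merge_own hm']
      exact ih hp

theorem done_mono {m m' : ℕ} (hm : m ≤ m') (i : Fin n) : (a m i).done ≤ (a m' i).done := by
  induction m', hm using Nat.le_induction with
  | base => exact le_rfl
  | succ e _ ih =>
    refine ih.trans ?_
    rcases h.succ e i with hs | ⟨q, m', hm', hs⟩
    · generalize a (e + 1) i = s' at hs ⊢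
      cases hs <;> simp
    · rw [hs]

theorem of_done_eq {m m' : ℕ} (hm : m ≤ m') {i : Fin n} (hd : (a m i).done = (a m' i).done) :
    (a m' i).loc = (a m i).loc ∧
      ∀ k, (a m i).phase = Phase.back k → (a m' i).phase = Phase.back k := by
  induction m', hm using Nat.le_induction with
  | base => exact ⟨rfl, fun _ h => h⟩
  | succ e he ih =>
    have h1 := h.done_mono he i
    have h2 := h.done_mono (show e ≤ e + 1 by omega) i
    obtain ⟨ih1, ih2⟩ := ih (by omega)
    rcases h.succ e i with hs | ⟨q, m', hm', hs⟩
    · generalize a (e + 1) i = s' at hs hd ⊢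
      cases hs with
      | stay => exact ⟨ih1, ih2⟩
      | start v hp =>
        exact ⟨ih1, fun k hk => absurd (ih2 k hk) (by simp [hp])⟩
      | turn j κ hp =>
        exact ⟨ih1, fun k hk => absurd (ih2 k hk) (by simp [hp])⟩
      | finishWrite => simp at hd; omega
      | finishRead => simp at hd; omega
    · rw [hs]; exact ⟨ih1, ih2⟩

end Commit

end IsEmu

end Algorithm

end SharedMemory

/-! ### Linearization of the emulated operations. -/

namespace SharedMemory

variable {n : ℕ} {In : Type u} {Out : Type v}

namespace Algorithm

variable {A : Algorithm n ℕ In Out} {t : ℕ} {σ : Fin n → In} {a : ℕ → Fin n → Emu n A.State}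

/-- The read operation number `c` of process `i` returns the value of the entry `k`, if it
terminates. -/
def HasResult (a : ℕ → Fin n → Emu n A.State) (i : Fin n) (c k : ℕ) : Prop :=
  ∃ e, (a e i).done = c ∧ (a e i).phase = Phase.back k

/-- The entry returned by the read operation number `c` of process `i`. -/
noncomputable def result (a : ℕ → Fin n → Emu n A.State) (i : Fin n) (c : ℕ) : ℕ :=
  Classical.epsilon (HasResult a i c)

/-- The current operation of process `i` has taken effect before time `m`. -/
def Lin (t : ℕ) (a : ℕ → Fin n → Emu n A.State) (m : ℕ) (i : Fin n) : Prop :=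
  match A.op i (a m i).loc with
  | Op.read j _ => (∃ k, HasResult a i (a m i).done k) ∧ ∃ l < m, (a l i).done = (a m i).done ∧
      result a i (a m i).done ≤ committed t a j l
  | Op.write _ _ => (a m i).phase = Phase.query ∧ Known t a ((a m i).know i i) i m

/-- The current operation of process `i` takes effect at step `m`. -/
def Fire (t : ℕ) (a : ℕ → Fin n → Emu n A.State) (m : ℕ) (i : Fin n) : Prop :=
  ¬ Lin t a m i ∧ match A.op i (a m i).loc with
  | Op.read j _ => (∃ k, HasResult a i (a m i).done k) ∧
      result a i (a m i).done ≤ committed t a j m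
  | Op.write _ _ => (a m i).phase = Phase.query ∧ Known t a ((a m i).know i i) i (m + 1)

/-- The emulated local state of process `i` after its current operation. -/
noncomputable def afterOp (a : ℕ → Fin n → Emu n A.State) (m : ℕ) (i : Fin n) : A.State :=
  match A.op i (a m i).loc with
  | Op.read _ κ => κ (entryVal (result a i (a m i).done))
  | Op.write _ s => s

open scoped Classical in
/-- The configuration of the emulated algorithm at time `m`. -/
noncomputable def emulated (t : ℕ) (a : ℕ → Fin n → Emu n A.State) (m : ℕ) : Config A where
  reg := fun j => entryVal (committed t a j m)
  loc := fun i => if Lin t a m i then afterOp a m i else (a m i).loc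

namespace IsEmu

variable (h : A.IsEmu t σ a)
include h

/-- `result` looks into the future of the execution. It is well defined because a process in its
write-back phase keeps its entry until the operation ends. -/
theorem result_eq {i : Fin n} {m k : ℕ} (hk : (a m i).phase = Phase.back k) :
    result a i (a m i).done = k := by
  have hex : HasResult a i (a m i).done k := ⟨m, rfl, hk⟩
  obtain ⟨e, he, hr⟩ := Classical.epsilon_spec (p := HasResult a i (a m i).done) ⟨k, hex⟩
  change (a e i).phase = Phase.back (result a i (a m i).done) at hr
  rcases le_total e m with hle | hle
  · have := (h.of_done_eq hle he).2 _ hr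
    rw [hk] at this
    simpa using this.symm
  · have := (h.of_done_eq hle he.symm).2 _ hk
    rw [hr] at this
    simpa using this

theorem not_lin_of_done_lt {m : ℕ} {i : Fin n} (hd : (a m i).done < (a (m + 1) i).done)
    (hp : (a (m + 1) i).phase = Phase.idle) : ¬ Lin t a (m + 1) i := by
  unfold Lin
  cases A.op i (a (m + 1) i).loc with
  | read j κ =>
    rintro ⟨-, l, hl, hdl, -⟩
    have := h.done_mono (show l ≤ m by omega) i
    omega
  | write w s =>
    rintro ⟨h1, -⟩
    rw [hp] at h1
    simp at h1

/-- One step of the linearization of the operations of process `i`. -/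
theorem lin_succ (ht : t + 1 < n) (m : ℕ) (i : Fin n) :
    ((a (m + 1) i).done = (a m i).done ∧ (a (m + 1) i).loc = (a m i).loc ∧
      (Lin t a (m + 1) i ↔ Lin t a m i ∨ Fire t a m i)) ∨
    ((a (m + 1) i).done = (a m i).done + 1 ∧ (a (m + 1) i).loc = afterOp a m i ∧
      (Lin t a m i ∨ Fire t a m i) ∧ ¬ Lin t a (m + 1) i) := by
  have hsame : ∀ (_ : (a (m + 1) i).done = (a m i).done) (_ : (a (m + 1) i).loc = (a m i).loc)
      (_ : ∀ w s, A.op i (a m i).loc = Op.write w s →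
        ((a (m + 1) i).phase = Phase.query ∧
          Known t a ((a (m + 1) i).know i i) i (m + 1) ↔
        (a m i).phase = Phase.query ∧ Known t a ((a m i).know i i) i (m + 1))),
      (a (m + 1) i).done = (a m i).done ∧ (a (m + 1) i).loc = (a m i).loc ∧
        (Lin t a (m + 1) i ↔ Lin t a m i ∨ Fire t a m i) := by
    intro hd hl hw
    refine ⟨hd, hl, ?_⟩
    have hor : Lin t a m i ∨ Fire t a m i ↔ Lin t a m i ∨ (match A.op i (a m i).loc with
      | Op.read j _ => (∃ k, HasResult a i (a m i).done k) ∧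
          result a i (a m i).done ≤ committed t a j m
      | Op.write _ _ => (a m i).phase = Phase.query ∧
          Known t a ((a m i).know i i) i (m + 1)) := by
      unfold Fire; tauto
    rw [hor]
    unfold Lin
    rw [hl, hd]
    cases hop : A.op i (a m i).loc with
    | read j κ =>
      constructor
      · rintro ⟨h1, l, h2, h3, h4⟩
        rcases Nat.lt_succ_iff_lt_or_eq.1 h2 with h5 | rfl
        · exact Or.inl ⟨h1, l, h5, h3, h4⟩
        · exact Or.inr ⟨h1, h4⟩
      · rintro (⟨h1, l, h2, h3, h4⟩ | ⟨h1, h2⟩)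
        · exact ⟨h1, l, by omega, h3, h4⟩
        · exact ⟨h1, m, by omega, rfl, h2⟩
    | write w s =>
      simp only
      rw [hw w s hop]
      constructor
      · exact Or.inr
      · rintro (⟨h1, h2⟩ | h1)
        · exact ⟨h1, h.known_mono (Nat.le_succ m) h2⟩
        · exact h1
  rcases h.succ m i with hs | ⟨q, m', hm', hs⟩
  · generalize hs' : a (m + 1) i = s' at hs
    rw [← hs']
    cases hs with
    | stay =>
      left
      apply hsame <;> rw [hs']
      intro w s _
      exact Iff.rfl
    | start v hp hr hw =>
      left
      apply hsame
      · rw [hs']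
      · rw [hs']
      · intro w s _
        -- Announcing a write does not make it effective at once: a quorum has `n - t ≥ 2` members,
        -- and a fresh entry is known only to its issuer.
        constructor
        · rintro ⟨-, hk⟩
          exact absurd hk (h.not_known_of_lt ht (by rw [hs']; exact lt_bump _ _ _))
        · rintro ⟨hk, -⟩
          rw [hp] at hk
          simp at hk
    | turn j κ hp hop hq =>
      left
      apply hsame
      · rw [hs']
      · rw [hs']
      · intro w s hop'
        rw [hop] at hop'
        simp at hop'
    | finishWrite w s hp hop hq =>
      right
      refine ⟨by rw [hs'], ?_, ?_, ?_⟩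
      · rw [hs', afterOp, hop]
      · left
        rw [Lin, hop]
        exact ⟨hp, h.known_of_quorum hq⟩
      · exact h.not_lin_of_done_lt (by rw [hs']; exact Nat.lt_succ_self _) (by rw [hs'])
    | finishRead k j κ hp hop hq =>
      have hres := h.result_eq hp
      right
      refine ⟨by rw [hs'], ?_, ?_, ?_⟩
      · rw [hs', afterOp, hop, hres]
      · by_cases hL : Lin t a m i
        · exact Or.inl hL
        · right
          rw [Fire, hop]
          refine ⟨hL, ⟨k, m, rfl, hp⟩, ?_⟩
          rw [hres]
          exact h.result_le_committed (by omega) hp hop hq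
      · exact h.not_lin_of_done_lt (by rw [hs']; exact Nat.lt_succ_self _) (by rw [hs'])
  · left
    apply hsame
    · rw [hs]
    · rw [hs]
    · intro w s _
      rw [hs]
      simp only [h.merge_own hm']

theorem emulated_zero : emulated t a 0 = A.init σ := by
  have hL : ∀ i, ¬ Lin t a 0 i := by
    intro i
    unfold Lin
    cases A.op i (a 0 i).loc with
    | read j κ => rintro ⟨-, l, hl, -⟩; omega
    | write w s => rintro ⟨h1, -⟩; simp [h.zero, emuStart] at h1
  have hc : ∀ j, committed t a j 0 = Nat.pair 0 (A.regInit j) := by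
    intro j
    unfold committed
    simp [h.zero, emuStart]
  simp only [emulated, init, hL, hc, if_false, h.zero, emuStart, entryVal, Nat.unpair_pair]

theorem emulated_loc_succ (ht : t + 1 < n) (m : ℕ) (i : Fin n) :
    (Fire t a m i → (emulated t a (m + 1)).loc i = afterOp a m i) ∧
    (¬ Fire t a m i → (emulated t a (m + 1)).loc i = (emulated t a m).loc i) := by
  simp only [emulated]
  rcases h.lin_succ ht m i with ⟨h1, h2, h3⟩ | ⟨h1, h2, h3, h4⟩
  · have hafter : afterOp a (m + 1) i = afterOp a m i := by simp only [afterOp, h1, h2]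
    refine ⟨fun hF => ?_, fun hF => ?_⟩
    · rw [if_pos (h3.2 (Or.inr hF)), hafter]
    · have : Lin t a (m + 1) i ↔ Lin t a m i := by tauto
      rw [hafter, h2]
      by_cases hL : Lin t a m i
      · rw [if_pos hL, if_pos (this.2 hL)]
      · rw [if_neg hL, if_neg (mt this.1 hL)]
  · refine ⟨fun hF => ?_, fun hF => ?_⟩
    · rw [if_neg h4, h2]
    · rw [if_neg h4, if_pos (h3.resolve_right hF), h2]

/-- A read takes effect when the committed entry is the one that it returns. -/
theorem result_eq_committed (ht : 2 * t < n) (ht' : t + 1 < n) {m : ℕ} {i j : Fin n}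
    {κ : ℕ → A.State} (hop : A.op i (a m i).loc = Op.read j κ) (hF : Fire t a m i) :
    result a i (a m i).done = committed t a j m := by
  obtain ⟨hL, hF⟩ := hF
  rw [hop] at hF
  obtain ⟨⟨k, e, hed, hek⟩, hle⟩ := hF
  have hres : result a i (a m i).done = k := hed ▸ h.result_eq hek
  rw [hres] at hle ⊢
  have hloc : (a e i).loc = (a m i).loc := by
    rcases le_total e m with hem | hem
    · exact ((h.of_done_eq hem hed).1).symm
    · exact (h.of_done_eq hem hed.symm).1
  -- If the operation is still unannounced at time `m`, its query comes later and quorum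
  -- intersection gives the missing inequality.
  have hopen : (a m i).phase = Phase.idle → k = committed t a j m := by
    intro hidle
    refine le_antisymm hle ?_
    rcases le_total e m with hem | hem
    · have := (h.of_done_eq hem hed).2 _ hek
      rw [hidle] at this
      simp at this
    · exact (h.committed_le_result ht hop hidle hem hed).2.2 k hek
  cases m with
  | zero => exact hopen (by simp [h.zero, emuStart])
  | succ m =>
    rcases h.lin_succ ht' m i with ⟨h1, h2, -⟩ | ⟨h1, -⟩
    · obtain ⟨j', κ', hop', ⟨m', hk⟩, -⟩ := h.back_spec hek
      rw [hloc, hop] at hop'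
      simp only [Op.read.injEq] at hop'
      obtain ⟨rfl, -⟩ := hop'
      rw [hk]
      -- The previous moment belongs to the same operation, and the committed entry was then below
      -- the result, or the read would already have taken effect. Committed entries skip nothing, so
      -- it now equals the result.
      refine (h.committed_succ_eq (by omega) ?_ (hk ▸ hle)).symm
      by_contra hlt
      apply hL
      rw [Lin, hop]
      refine ⟨⟨k, e, hed, hek⟩, m, Nat.lt_succ_self m, h1.symm, ?_⟩
      rw [hres, hk]
      exact not_lt.1 hlt
    · apply hopen
      rcases h.succ m i with hs | ⟨q, m', hm', hs⟩
      · generalize a (m + 1) i = s' at hs h1 ⊢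
        cases hs <;> simp at h1 ⊢
      · rw [hs] at h1
        simp at h1

theorem nextLoc_emulated (ht : 2 * t < n) (ht' : t + 1 < n) {m : ℕ} {i : Fin n}
    (hF : Fire t a m i) : A.nextLoc (emulated t a m) i = afterOp a m i := by
  have hloc : (emulated t a m).loc i = (a m i).loc := by simp [emulated, hF.1]
  rw [nextLoc, afterOp, hloc]
  cases hop : A.op i (a m i).loc with
  | read j κ =>
    simp only [emulated]
    rw [h.result_eq_committed ht ht' hop hF]
  | write w s => rfl

/-- The committed entry moves exactly when the current entry becomes known to a quorum. For a write
this is the moment when it fires; for a read the new entry repeats the value, so the emulated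
register does not change. -/
theorem emulated_reg_succ (ht : t + 1 < n) (m : ℕ) (j : Fin n) :
    (Fire t a m j → (emulated t a (m + 1)).reg j = A.nextReg (emulated t a m) j) ∧
    (¬ Fire t a m j → (emulated t a (m + 1)).reg j = (emulated t a m).reg j) := by
  have hnext : ∀ hF : Fire t a m j, A.nextReg (emulated t a m) j =
      match A.op j (a m j).loc with
      | Op.read _ _ => entryVal (committed t a j m)
      | Op.write w _ => w := by
    intro hF
    have hloc : (emulated t a m).loc j = (a m j).loc := by simp [emulated, hF.1]
    rw [nextReg, hloc]
    cases A.op j (a m j).loc <;> rfl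
  suffices hs : (Fire t a m j → entryVal (committed t a j (m + 1)) =
      match A.op j (a m j).loc with
      | Op.read _ _ => entryVal (committed t a j m)
      | Op.write w _ => w) ∧
      (¬ Fire t a m j → entryVal (committed t a j (m + 1)) = entryVal (committed t a j m)) from
    ⟨fun hF => (hs.1 hF).trans (hnext hF).symm, hs.2⟩
  rcases h.own_succ m j with ⟨h1, h2⟩ | ⟨h1, h2, h3⟩
  · by_cases hk : Known t a ((a m j).know j j) j m
    · have hc : committed t a j (m + 1) = committed t a j m := by
        rw [committed, committed, if_pos hk, if_pos, h1]
        rw [h1]; exact h.known_mono (Nat.le_succ m) hk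
      rw [hc]
      refine ⟨fun hF => ?_, fun _ => rfl⟩
      obtain ⟨hL, hF⟩ := hF
      unfold Lin at hL
      cases hop : A.op j (a m j).loc with
      | read _ _ => rfl
      | write w s =>
        rw [hop] at hF hL
        exact absurd ⟨hF.1, hk⟩ hL
    · by_cases hk' : Known t a ((a m j).know j j) j (m + 1)
      · have hc : committed t a j (m + 1) = (a m j).know j j := by
          rw [committed, if_pos (by rw [h1]; exact hk'), h1]
        have hc' : committed t a j m = (a m j).prev := by rw [committed, if_neg hk]
        have hidle : (a m j).phase ≠ Phase.idle := fun hi => hk ((h.known_prev_and m j).2 hi)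
        obtain ⟨hw, hr⟩ := h.entryVal_own hidle
        rw [hc, hc']
        cases hop : A.op j (a m j).loc with
        | read j' κ =>
          exact ⟨fun _ => hr j' κ hop, fun _ => hr j' κ hop⟩
        | write w s =>
          refine ⟨fun _ => hw w s hop, fun hF => absurd ?_ hF⟩
          have hq : (a m j).phase = Phase.query := by
            cases hp : (a m j).phase with
            | idle => exact absurd hp hidle
            | query => rfl
            | back k =>
              obtain ⟨j', κ, hop', -⟩ := h.back_spec hp
              rw [hop] at hop'
              simp at hop'
          rw [Fire, Lin, hop]
          exact ⟨fun hL => hk hL.2, hq, hk'⟩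
      · have hc : committed t a j (m + 1) = committed t a j m := by
          rw [committed, committed, if_neg hk, if_neg (by rw [h1]; exact hk'), h2]
        rw [hc]
        refine ⟨fun hF => ?_, fun _ => rfl⟩
        obtain ⟨-, hF⟩ := hF
        cases hop : A.op j (a m j).loc with
        | read _ _ => rfl
        | write w s =>
          rw [hop] at hF
          exact absurd hF.2 hk'
  · have hk : Known t a ((a m j).know j j) j m := by
      rcases h3 with hp | hq
      · exact (h.known_prev_and m j).2 hp
      · exact h.known_of_quorum hq
    have hc : committed t a j (m + 1) = committed t a j m := by
      rw [committed, committed, if_pos hk, if_neg (h.not_known_of_lt ht h1), h2]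
    rw [hc]
    refine ⟨fun hF => ?_, fun _ => rfl⟩
    obtain ⟨hL, hF⟩ := hF
    unfold Lin at hL
    cases hop : A.op j (a m j).loc with
    | read _ _ => rfl
    | write w s =>
      rw [hop] at hF hL
      exact absurd ⟨hF.1, hk⟩ hL

/-- The emulated configurations form a run, up to batches of steps by distinct processes. -/
theorem exists_emulated_batch (ht : 2 * t < n) (ht' : t + 1 < n) (m : ℕ) :
    ∃ l : List (Fin n), (∀ i, i ∈ l ↔ Fire t a m i) ∧
      l.foldl (fun c i => A.stepBy i c) (emulated t a m) = emulated t a (m + 1) := by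
  obtain ⟨l, hl, hstep⟩ := A.exists_batch (emulated t a m) (Fire t a m)
  refine ⟨l, hl, hstep _ ?_ ?_ ?_ ?_⟩
  · exact fun j => (h.emulated_reg_succ ht' m j).1
  · exact fun j => (h.emulated_reg_succ ht' m j).2
  · exact fun j hF => ((h.emulated_loc_succ ht' m j).1 hF).trans
      (h.nextLoc_emulated ht ht' hF).symm
  · exact fun j => (h.emulated_loc_succ ht' m j).2

theorem output_emulated_mono (ht : 2 * t < n) (ht' : t + 1 < n) {m m' : ℕ} (hm : m ≤ m')
    {i : Fin n} {o : Out} (ho : A.output i ((emulated t a m).loc i) = some o) :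
    A.output i ((emulated t a m').loc i) = some o := by
  induction m', hm using Nat.le_induction with
  | base => exact ho
  | succ m' _ ih =>
    by_cases hF : Fire t a m' i
    · rw [(h.emulated_loc_succ ht' m' i).1 hF, ← h.nextLoc_emulated ht ht' hF]
      exact A.output_nextLoc _ _ ih
    · rw [(h.emulated_loc_succ ht' m' i).2 hF]
      exact ih

theorem exists_done_succ (ht : t + 1 < n) {i : Fin n} {m m' : ℕ}
    (hd : (a m i).done < (a m' i).done) :
    ∃ e ≥ m, (a (e + 1) i).done = (a e i).done + 1 ∧ (a (e + 1) i).loc = afterOp a e i ∧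
      (Lin t a e i ∨ Fire t a e i) ∧ ¬ Lin t a (e + 1) i := by
  have hmm : m ≤ m' := by
    by_contra hc
    have := h.done_mono (show m' ≤ m by omega) i
    omega
  by_contra hno
  push Not at hno
  have : ∀ e, m ≤ e → (a e i).done = (a m i).done := by
    intro e he
    induction e, he using Nat.le_induction with
    | base => rfl
    | succ e he ih =>
      rcases h.lin_succ ht e i with ⟨h1, -⟩ | ⟨h1, h2, h3, h4⟩
      · omega
      · exact absurd (hno e he h1 h2 h3) h4
  have := this m' hmm
  omega

/-- An operation cannot end without having taken effect. Two completions are needed after time `m`,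
since the operation in progress at `m` may have taken effect before. -/
theorem fire_infinitely_often (ht : t + 1 < n) {i : Fin n}
    (hprog : ∀ m, ∃ m', (a m i).done < (a m' i).done) (m : ℕ) :
    ∃ m', m ≤ m' ∧ Fire t a m' i := by
  by_contra hno
  push Not at hno
  obtain ⟨m₁, hm₁⟩ := hprog m
  have key : ∀ e, m ≤ e → (a m i).done < (a e i).done → ¬ Lin t a e i := by
    intro e he
    induction e, he using Nat.le_induction with
    | base => exact fun hlt => absurd hlt (lt_irrefl _)
    | succ e he ih =>
      intro hlt
      rcases h.lin_succ ht e i with ⟨h1, -, h3⟩ | ⟨-, -, -, h4⟩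
      · rw [h3]
        rintro (hL | hF)
        · exact ih (by omega) hL
        · exact hno e he hF
      · exact h4
  obtain ⟨m₂, hm₂⟩ := hprog m₁
  obtain ⟨e, he, -, -, hLF, -⟩ := h.exists_done_succ ht hm₂
  have hmm : m ≤ m₁ := by
    by_contra hc
    have := h.done_mono (show m₁ ≤ m by omega) i
    omega
  rcases hLF with hL | hF
  · exact key e (by omega) (lt_of_lt_of_le hm₁ (h.done_mono he i)) hL
  · exact hno e (by omega) hF

/-- A crashed process stays in one operation, which takes effect at most once, possibly after the
crash. -/
theorem fire_finitely_often (ht : t + 1 < n) {i : Fin n} {N : ℕ}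
    (hhalt : ∀ m, N ≤ m → a (m + 1) i = a m i) : ¬ ∀ m, ∃ m', m ≤ m' ∧ Fire t a m' i := by
  intro hinf
  obtain ⟨m₁, hm₁, hF₁⟩ := hinf N
  obtain ⟨m₂, hm₂, hF₂⟩ := hinf (m₁ + 1)
  have key : ∀ e, m₁ + 1 ≤ e → Lin t a e i := by
    intro e he
    have hstep : ∀ e, N ≤ e → (Lin t a (e + 1) i ↔ Lin t a e i ∨ Fire t a e i) := by
      intro e he
      rcases h.lin_succ ht e i with ⟨-, -, h3⟩ | ⟨h1, -⟩
      · exact h3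
      · rw [hhalt e he] at h1; omega
    induction e, he using Nat.le_induction with
    | base => exact (hstep m₁ hm₁).2 (Or.inr hF₁)
    | succ e he ih => exact (hstep e (by omega)).2 (Or.inl ih)
  exact hF₂.1 (key m₂ hm₂)

/-- Every emulation in which the correct processes complete infinitely many operations has the
outcome of some run of the emulated algorithm with the same correct processes. -/
theorem exists_run (ht : 2 * t < n) (ht' : t + 1 < n) (sch : ℕ → Fin n) (hres : Resilient t sch)
    (hcrash : ∀ m i, sch m ≠ i → a (m + 1) i = a m i)
    (hprog : ∀ i, Correct sch i → ∀ m, ∃ m', (a m i).done < (a m' i).done) :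
    ∃ sch' : ℕ → Fin n, (∀ i, Correct sch' i ↔ Correct sch i) ∧
      ∀ i o, Correct sch i → A.Decides σ sch' i o → ∃ m, A.output i (a m i).loc = some o := by
  choose l hl hstep using h.exists_emulated_batch ht ht'
  have hcorr : ∀ i, (∀ m, ∃ m', m ≤ m' ∧ Fire t a m' i) ↔ Correct sch i := by
    intro i
    constructor
    · intro hinf
      by_contra hc
      unfold Correct at hc
      push Not at hc
      obtain ⟨N, hN⟩ := hc
      exact h.fire_finitely_often ht' (N := N) (fun m hm => hcrash m i (hN m hm)) hinf
    · exact fun hc => h.fire_infinitely_often ht' (hprog i hc)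
  -- A correct process exists because `t < n`; it ensures that the batches do not end up all empty.
  obtain ⟨i₀, hi₀⟩ : ∃ i, Correct sch i := by
    by_contra hno
    push Not at hno
    have : {i : Fin n | ¬ Correct sch i} = Set.univ := Set.eq_univ_of_forall hno
    rw [Resilient, this, Set.ncard_univ, Nat.card_eq_fintype_card, Fintype.card_fin] at hres
    omega
  obtain ⟨sch', pos, hrun, hpos, hcorr'⟩ := A.exists_schedule σ (emulated t a) l h.emulated_zero
    hstep (fun m => by
      obtain ⟨m', hm', hF⟩ := (hcorr i₀).2 hi₀ m
      exact ⟨m', hm', List.ne_nil_of_mem ((hl m' i₀).2 hF)⟩)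
  refine ⟨sch', fun i => ?_, fun i o hi hdec => ?_⟩
  · rw [hcorr' i, ← hcorr i]
    simp only [hl]
  · obtain ⟨x, hx⟩ := hdec
    obtain ⟨m, hm⟩ := hpos x
    have ho := A.output_run_mono σ sch' i hm hx
    rw [hrun] at ho
    obtain ⟨m', hm'⟩ := hprog i hi m
    -- Just after a completed operation the next one has not taken effect, so the emulated and the
    -- actual local state agree and the decision is visible.
    obtain ⟨e, he, -, -, -, hL⟩ := h.exists_done_succ ht' hm'
    refine ⟨e + 1, ?_⟩
    have := h.output_emulated_mono ht ht' (show m ≤ e + 1 by omega) ho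
    simpa [emulated, hL] using this

end IsEmu

/-! ### Termination of the emulated operations of correct processes. -/

/-- A measure of the progress of the emulation. -/
def Phase.rank : Phase → ℕ
  | Phase.idle => 0
  | Phase.query => 1
  | Phase.back _ => 2

namespace IsEmu

variable (h : A.IsEmu t σ a)
include h

/-- The weight 3 exceeds every rank, so each change of phase raises the score, including the return
to `idle`; and an entry is issued only with a change of phase. -/
theorem score_succ (m : ℕ) (i : Fin n) :
    3 * (a m i).done + Phase.rank (a m i).phase ≤
      3 * (a (m + 1) i).done + Phase.rank (a (m + 1) i).phase ∧
    (3 * (a m i).done + Phase.rank (a m i).phase =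
      3 * (a (m + 1) i).done + Phase.rank (a (m + 1) i).phase →
      (a (m + 1) i).know i i = (a m i).know i i) := by
  rcases h.succ m i with hs | ⟨q, m', hm', hs⟩
  · generalize a (m + 1) i = s' at hs ⊢
    cases hs with
    | stay => simp
    | start v hp => simp [hp, Phase.rank]
    | turn j κ hp => simp [hp, Phase.rank]
    | finishWrite w s hp => simp only [hp, Phase.rank]; omega
    | finishRead k j κ hp => simp only [hp, Phase.rank]; omega
  · rw [hs]
    exact ⟨le_rfl, fun _ => h.merge_own hm' i q⟩

theorem score_mono {m m' : ℕ} (hm : m ≤ m') (i : Fin n) :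
    3 * (a m i).done + Phase.rank (a m i).phase ≤
      3 * (a m' i).done + Phase.rank (a m' i).phase := by
  induction m', hm using Nat.le_induction with
  | base => exact le_rfl
  | succ m' _ ih => exact ih.trans (h.score_succ m' i).1

/-- The entry travels from `i` to each correct `p`, and the news that `p` knows it travels back.
There are at least `n - t` such `p`. -/
theorem exists_quorum (sch : ℕ → Fin n) (hres : Resilient t sch)
    (hspread : ∀ i j, Correct sch i → Correct sch j → ∀ m, ∃ m', (a m i).know ≤ (a m' j).know)
    {i : Fin n} (hi : Correct sch i) (m : ℕ) :
    ∃ m₁, ∀ m', m₁ ≤ m' → (a m' i).know i i = (a m i).know i i → Quorum t i (a m' i).know := by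
  have hp : ∀ p, ∃ M, Correct sch p → ∀ m', M ≤ m' → (a m i).know i i ≤ (a m' i).know p i := by
    intro p
    by_cases hc : Correct sch p
    · obtain ⟨M₁, h₁⟩ := hspread i p hi hc m
      obtain ⟨M₂, h₂⟩ := hspread p i hc hi M₁
      refine ⟨M₂, fun _ m' hm' => ?_⟩
      calc (a m i).know i i ≤ (a M₁ p).know i i := h₁ i i
        _ ≤ (a M₁ p).know p i := (h.know_sound M₁ p i).2 i
        _ ≤ (a M₂ i).know p i := h₂ p i
        _ ≤ (a m' i).know p i := h.know_mono hm' i p i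
    · exact ⟨0, fun hc' => absurd hc' hc⟩
  choose M hM using hp
  refine ⟨Finset.univ.sup M, fun m' hm' heq => ?_⟩
  classical
  have hcard : n - t ≤ (Finset.univ.filter fun p => Correct sch p).card := by
    have h1 : (Finset.univ.filter fun p => Correct sch p).card +
        (Finset.univ.filter fun p => ¬ Correct sch p).card = n := by
      rw [Finset.card_filter_add_card_filter_not, Finset.card_univ, Fintype.card_fin]
    have h2 : (Finset.univ.filter fun p => ¬ Correct sch p).card ≤ t := by
      rw [Resilient, Set.ncard_eq_toFinset_card'] at hres
      convert hres using 2
      ext; simp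
    omega
  refine hcard.trans (Finset.card_le_card (Finset.monotone_filter_right _ fun p _ hp => ?_))
  rw [heq]
  exact hM p hp m' ((Finset.le_sup (Finset.mem_univ p)).trans hm')

/-- With a constant score the own entry is constant, so a quorum is eventually seen and the next
tick raises the score. As ranks are at most 2, an unbounded score means unboundedly many completed
operations. -/
theorem done_unbounded (sch : ℕ → Fin n) (hres : Resilient t sch)
    (hspread : ∀ i j, Correct sch i → Correct sch j → ∀ m, ∃ m', (a m i).know ≤ (a m' j).know)
    (htick : ∀ i, Correct sch i → ∀ m, ∃ m' ≥ m, a (m' + 1) i = A.emuTick t i (a m' i))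
    {i : Fin n} (hi : Correct sch i) (m : ℕ) : ∃ m', (a m i).done < (a m' i).done := by
  have hleave : ∀ m, ∃ m', 3 * (a m i).done + Phase.rank (a m i).phase <
      3 * (a m' i).done + Phase.rank (a m' i).phase := by
    intro m
    by_contra hno
    push Not at hno
    have hconst : ∀ e, m ≤ e → 3 * (a e i).done + Phase.rank (a e i).phase =
        3 * (a m i).done + Phase.rank (a m i).phase :=
      fun e he => le_antisymm (hno e) (h.score_mono he i)
    have hown : ∀ e, m ≤ e → (a e i).know i i = (a m i).know i i := by
      intro e he
      induction e, he using Nat.le_induction with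
      | base => rfl
      | succ e he ih =>
        rw [(h.score_succ e i).2 (by rw [hconst e he, hconst (e + 1) (by omega)]), ih]
    obtain ⟨m₁, hm₁⟩ := h.exists_quorum sch hres hspread hi m
    obtain ⟨e, he, htk⟩ := htick i hi (max m m₁)
    have hq := hm₁ e (by omega) (hown e (by omega))
    have hc := (hconst e (by omega)).trans (hconst (e + 1) (by omega)).symm
    rw [htk] at hc
    unfold emuTick at hc
    cases hp : (a e i).phase with
    | idle => simp [hp, Phase.rank] at hc
    | query =>
      cases hop : A.op i (a e i).loc with
      | read j κ => simp [hp, hq, hop, Phase.rank] at hc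
      | write w s => simp [hp, hq, hop, Phase.rank] at hc; omega
    | back k =>
      obtain ⟨j, κ, hop, -⟩ := h.back_spec hp
      simp [hp, hq, hop, Phase.rank] at hc
      omega
  have hmany : ∀ N, ∃ m', N ≤ 3 * (a m' i).done + Phase.rank (a m' i).phase := by
    intro N
    induction N with
    | zero => exact ⟨0, Nat.zero_le _⟩
    | succ N ih =>
      obtain ⟨m₁, h₁⟩ := ih
      obtain ⟨m₂, h₂⟩ := hleave m₁
      exact ⟨m₂, by omega⟩
  obtain ⟨m', hm'⟩ := hmany (3 * (a m i).done + 3)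
  refine ⟨m', ?_⟩
  have : Phase.rank (a m' i).phase ≤ 2 := by
    cases (a m' i).phase <;> simp [Phase.rank]
  omega

end IsEmu

/-- The emulation as a protocol. -/
noncomputable def protocol (A : Algorithm n ℕ In Out) (t : ℕ) :
    Protocol n (Fin n → Fin n → ℕ) In Out where
  State := Emu n A.State
  start := A.emuStart
  pay := Emu.know
  pay₀ := fun _ q => Nat.pair 0 (A.regInit q)
  pay_start := fun _ _ => rfl
  tick := A.emuTick t
  recv := fun i j s L => { s with know := merge i j s.know L }
  output := fun i s => A.output i s.loc
  output_tick := by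
    intro i s o ho
    have hs := A.emuStep_emuTick t i s
    generalize A.emuTick t i s = s' at hs ⊢
    cases hs with
    | stay => exact ho
    | start => exact ho
    | turn => exact ho
    | finishWrite w s' _ hop _ => exact A.output_write i _ w s' o hop ho
    | finishRead k j κ _ hop _ => exact A.output_read i _ j κ o hop ho _
  output_recv := fun _ _ _ _ _ ho => ho

end Algorithm

/-! ### Connectivity of the ring, and assembly of the simulation. -/

/-- If information flows from every correct process to the correct ones among its `t + 1`
successors on the ring, then it flows between all correct processes. -/
theorem correct_connected {t : ℕ} [NeZero n] (ht : t + 1 < n) (sch : ℕ → Fin n)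
    (hres : Resilient t sch) (R : Fin n → Fin n → Prop) (hrefl : ∀ i, R i i)
    (htrans : ∀ i j k, R i j → R j k → R i k)
    (hlink : ∀ i (d : Fin (t + 1)), Correct sch i → Correct sch (i + Fin.ofNat n (d + 1)) →
      R i (i + Fin.ofNat n (d + 1)))
    (i j : Fin n) (hi : Correct sch i) (hj : Correct sch j) : R i j := by
  generalize hN : (j - i).val = N
  induction N using Nat.strong_induction_on generalizing i with
  | _ N ih =>
  have hadd : ∀ e < n, (Fin.ofNat n e).val = e := fun e he => Nat.mod_eq_of_lt he
  by_cases hNt : N ≤ t + 1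
  · rcases Nat.eq_zero_or_pos N with rfl | hpos
    · have : j = i := sub_eq_zero.1 (Fin.ext hN)
      exact this ▸ hrefl i
    · have hji : j = i + Fin.ofNat n ((⟨N - 1, by omega⟩ : Fin (t + 1)) + 1) := by
        rw [eq_comm, ← eq_sub_iff_add_eq']
        apply Fin.ext
        rw [hadd _ (by simp only; omega), hN]
        simp only
        omega
      have := hlink i ⟨N - 1, by omega⟩ hi (by rw [← hji]; exact hj)
      rwa [← hji] at this
  -- The `t + 1` successors are distinct, so they cannot all have crashed. As `j` is further than `t
  -- + 1` away, the hop does not overshoot it and shortens the distance.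
  · obtain ⟨d, hd⟩ : ∃ d : Fin (t + 1), Correct sch (i + Fin.ofNat n (d + 1)) := by
      by_contra hno
      push Not at hno
      have hinj : Function.Injective fun d : Fin (t + 1) => i + Fin.ofNat n (d + 1) := by
        intro d d' hdd
        have h1 : Fin.ofNat n (d + 1) = Fin.ofNat n (d' + 1) := add_left_cancel hdd
        have h2 := congrArg Fin.val h1
        rw [hadd _ (by omega), hadd _ (by omega)] at h2
        exact Fin.ext (by omega)
      have hsub : Set.range (fun d : Fin (t + 1) => i + Fin.ofNat n (d + 1)) ⊆
          {i | ¬ Correct sch i} := by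
        rintro _ ⟨d, rfl⟩
        exact hno d
      have h1 := Set.ncard_le_ncard hsub (Set.toFinite _)
      rw [Set.ncard_range_of_injective hinj, Nat.card_eq_fintype_card, Fintype.card_fin] at h1
      have := h1.trans hres
      omega
    refine htrans _ _ _ (hlink i d hi hd) (ih (N - (d + 1)) (by omega) _ hd ?_)
    rw [← sub_sub, Fin.sub_val_of_le, hadd _ (by omega), hN]
    rw [Fin.le_def, hadd _ (by omega), hN]
    omega

/-- The link number `d` goes from `i` to `i + d + 1`. -/
def ringLink (n : ℕ) [NeZero n] (t : ℕ) (d : Fin (t + 1)) : Equiv.Perm (Fin n) :=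
  Equiv.addRight (Fin.ofNat n (d + 1))

theorem ringLink_ne [NeZero n] {t : ℕ} (ht : t + 1 < n) (d : Fin (t + 1)) (i : Fin n) :
    ringLink n t d i ≠ i := by
  intro h
  have h1 : i + Fin.ofNat n (d + 1) = i := h
  rw [add_eq_left] at h1
  have h2 : (Fin.ofNat n (d + 1)).val = d + 1 := Nat.mod_eq_of_lt (by omega)
  rw [h1] at h2
  simp at h2

/-- The protocol states along a run over the links form an emulation, whose outcome is that of a run
of `A` with the same correct processes. -/
theorem Algorithm.Solves.algorithm_protocol {t : ℕ} [NeZero n] (ht : 2 * t < n)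
    (ht' : t + 1 < n) {A : Algorithm n ℕ In Out} {T : Task n In Out} (hA : A.Solves T t) :
    ((A.protocol t).algorithm (ringLink n t)).Solves T t := by
  intro σ hσ sch hres
  have hne := ringLink_ne (n := n) ht'
  set a : ℕ → Fin n → Emu n A.State := fun m i =>
    ((A.protocol t).node (ringLink n t) σ sch m i).app with ha
  have h : A.IsEmu t σ a := by
    refine ⟨fun i => rfl, fun m i => ?_⟩
    rcases (A.protocol t).app_step (ringLink n t) (σ := σ) (sch := sch) hne m i with
      h1 | ⟨-, h1 | ⟨j, m', hm', h1⟩⟩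
    · left
      change a (m + 1) i = a m i at h1
      rw [h1]
      exact EmuStep.stay
    · left
      change a (m + 1) i = A.emuTick t i (a m i) at h1
      rw [h1]
      exact A.emuStep_emuTick t i _
    · exact Or.inr ⟨j, m', hm', h1⟩
  have hspread : ∀ i j, Correct sch i → Correct sch j → ∀ m, ∃ m',
      (a m i).know ≤ (a m' j).know := by
    refine correct_connected ht' sch hres (fun i j => ∀ m, ∃ m', (a m i).know ≤ (a m' j).know)
      (fun i m => ⟨m, le_rfl⟩) ?_ ?_
    · intro i j k hij hjk m
      obtain ⟨m₁, h₁⟩ := hij m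
      obtain ⟨m₂, h₂⟩ := hjk m₁
      exact ⟨m₂, h₁.trans h₂⟩
    · intro i d hi hj m
      obtain ⟨m', hm', m₀, h₀⟩ := (A.protocol t).exists_delivery (ringLink n t) (σ := σ) hne
        (d := d) hi hj m
      refine ⟨m₀ + 1, (h.know_mono hm' i).trans ?_⟩
      set j := i + Fin.ofNat n (d + 1) with hjdef
      change a (m₀ + 1) j = { a m₀ j with know := merge j i (a m₀ j).know (a m' i).know } at h₀
      rw [h₀]
      intro p q
      by_cases hp : p = j
      · simp only [merge, hp, if_true, le_max_iff]
        exact Or.inr ((h.know_sound m' i j).2 q)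
      · simp only [merge, hp, if_false, le_max_iff]
        exact Or.inr le_rfl
  have hprog : ∀ i, Correct sch i → ∀ m, ∃ m', (a m i).done < (a m' i).done :=
    fun i hi => h.done_unbounded sch hres hspread
      (fun i hi m => (A.protocol t).exists_tick (ringLink n t) (σ := σ) hi m) hi
  obtain ⟨sch', hcorr, hdec⟩ := h.exists_run ht ht' sch hres
    (fun m i hi => by
      simp only [ha]
      rw [(A.protocol t).node_succ_of_ne (ringLink n t) σ sch hi]) hprog
  have hres' : Resilient t sch' := by
    unfold Resilient at hres ⊢
    simpa only [hcorr] using hres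
  obtain ⟨τ, hτ, hout⟩ := hA σ hσ sch' hres'
  refine ⟨τ, hτ, fun i => ⟨fun hi => ?_, fun hi => ?_⟩⟩
  · obtain ⟨o, ho, hd⟩ := (hout i).1 ((hcorr i).2 hi)
    exact ⟨o, ho, hdec i o hi hd⟩
  · exact (hout i).2 fun hc => hi ((hcorr i).1 hc)

theorem nonempty_ports_embedding {t : ℕ} (ht : 1 ≤ t) :
    Nonempty (Ports t ↪ (Fin (6 * t) → Bool)) := by
  apply Function.Embedding.nonempty_of_card_le
  simp only [Ports, Fintype.card_pi, Fintype.card_prod, Fintype.card_bool, Finset.prod_const,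
    Finset.card_univ, Fintype.card_fin]
  -- Three bits for each of the `t + 1` links; `3 * (t + 1) ≤ 6 * t` uses `1 ≤ t` and is the origin
  -- of the constant 6.
  calc (2 * (2 * 2)) ^ (t + 1) = 2 ^ (3 * (t + 1)) := by rw [pow_mul]; norm_num
    _ ≤ 2 ^ (6 * t) := Nat.pow_le_pow_right (by norm_num) (by omega)

end SharedMemory

theorem theorem3 :
    ∃ β : ℕ, 1 ≤ β ∧ ∀ n t : ℕ, 2 ≤ n → 1 ≤ t → 2 * t < n →
      ∀ (In : Type u) (Out : Type v) (T : SharedMemory.Task n In Out),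
        T.SolvableUnbounded t → T.SolvableBits t (β * t) := by
  refine ⟨6, by norm_num, fun n t hn ht htn In Out T hT => ?_⟩
  have : NeZero n := ⟨by omega⟩
  obtain ⟨A, hA⟩ := hT.solvableWith_nat (by omega)
  obtain ⟨f⟩ := SharedMemory.nonempty_ports_embedding ht
  exact SharedMemory.Task.SolvableWith.of_embedding
    ⟨_, hA.algorithm_protocol htn (by omega)⟩ f (by omega)
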